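/- Let $k$ be a field and let $(H,R)$ be a quasitriangular Hopf algebra over $k$ with antipode $S$: $R=\sum R^1\otimes R^2\in H\otimes H$ is invertible, $(\Delta\otimes \mathrm{id})(R)=R_{13}R_{23}$, $(\mathrm{id}\otimes\Delta)(R)=R_{13}R_{12}$ and $\Delta^{cop}(h)R=R\Delta(h)$ for all $h\in H$. Let $L=R_{(l)}=\{(\mathrm{id}\otimes p)(R) : p\in H^*\}$, a finite dimensional Hopf subalgebra of $H$. Let $V$ be a quantum commutative left $H$-module algebra, i.e. $h\cdot(vw)=\sum (h_1\cdot v)(h_2\cdot w)$, $h\cdot 1=\varepsilon(h)1$ and $vw=\sum (R^2\cdot w)(R^1\cdot v)$ for all $h\in H$, $v,w\in V$. Let $V\#L$ be the smash product, i.e. $V\otimes L$ with multiplication $(v\#l)(w\#m)=\sum v(l_1\cdot w)\#l_2m$, where $L$ acts on $V$ by restriction of the action of $H$. Then, for $u=\sum S(R^2)R^1$, the element $S(u)$ is invertible, and, with $d_0=S(u)^{-1}$, the algebra $V\#L$ is a Hopf algebroid over $V$ with source $\alpha(v)=v\#1$, target $\beta(v)=\sum R^2\cdot v\#R^1$, coproduct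 $\Delta(v\#l)=\sum (v\#l_1)\otimes_V(1\#l_2)$, counit $\varepsilon(v\#l)=\varepsilon(l)v$ and antipode $\tau(v\#l)=(1\#S(l))\,\beta(d_0\cdot v)$. Here a Hopf algebroid (in the sense of Lu) over an algebra $B$ is an algebra $T$ with the following data. An algebra homomorphism $\alpha:B\to T$ and an algebra anti-homomorphism $\beta:B\to T$ with $\alpha(b)\beta(b')=\beta(b')\alpha(b)$; they make $T$ a $B$-$B$-bimodule by $b\cdot t=\alpha(b)t$, $t\cdot b=\beta(b)t$. A coassociative $B$-$B$-bimodule map $\Delta:T\to T\otimes_BT$ with $\Delta(1)=1\otimes 1$ such that the kernel of $T\otimes T\otimes T\to T\otimes_BT$, $t\otimes t'\otimes t''\mapsto\Delta(t)(t'\otimes t'')$, is a left ideal of $T\otimes T^{op}\otimes T^{op}$. A $B$-$B$-bimodule map $\varepsilon:T\to B$ with $\varepsilon(1)=1$, whose kernel is a left ideal of $T$, such that $\sum\alpha(\varepsilon(t_1))t_2=t=\sum\beta(\varepsilon(t_2))t_1$ for all $t\in T$, where $\Delta(t)=\sum t_1\otimes t_2$. A linear algebra anti-isomorphism $\tau:T\to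 T$ with $\tau\beta=\alpha$ and $m_T(\tau\otimes \mathrm{id})\Delta=\beta\varepsilon\tau$, such that there is a linear section $\gamma$ of the projection $T\otimes T\to T\otimes_BT$ with $m_T(\mathrm{id}\otimes\tau)\gamma\Delta=\alpha\varepsilon$. -/

import Mathlib

open scoped TensorProduct
open MulOpposite

noncomputable section

universe u v w

/-! ### Bialgebroids and Hopf algebroids in the sense of Lu -/

/-- Source and target maps: `source : B → T` is an algebra homomorphism, `target : B → T` an
algebra anti-homomorphism (written as a homomorphism into the opposite algebra), and their images
commute elementwise. -/
structure SourceTarget (k : Type u) (B : Type v) (T : Type w) [Field k] [Ring B] [Algebra k B]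
    [Ring T] [Algebra k T] where
  source : B →ₐ[k] T
  target : B →ₐ[k] Tᵐᵒᵖ
  commute : ∀ b b' : B, source b * unop (target b') = unop (target b') * source b

namespace SourceTarget

variable {k : Type u} {B : Type v} {T : Type w} [Field k] [Ring B] [Algebra k B]
  [Ring T] [Algebra k T] (s : SourceTarget k B T)

/-- The target map as a `k`-linear map with values in `T`. -/
def tgt : B →ₗ[k] T := (opLinearEquiv k).symm.toLinearMap ∘ₗ s.target.toLinearMap

theorem tgt_mul (a b : B) : s.tgt (a * b) = s.tgt b * s.tgt a := by
  simp [tgt]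

theorem source_mul_tgt (a b : B) : s.source a * s.tgt b = s.tgt b * s.source a :=
  s.commute a b

/-- `T` is a `B`-`B`-bimodule by `b · t = source b * t` and `t · b = tgt b * t`. This is the
subspace of `T ⊗ T` by which one divides to get `T ⊗_B T`. -/
def balanced : Submodule k (T ⊗[k] T) :=
  Submodule.span k {z | ∃ (b : B) (t t' : T),
    z = (s.tgt b * t) ⊗ₜ[k] t' - t ⊗ₜ[k] (s.source b * t')}

/-- The tensor product `T ⊗_B T`. -/
abbrev TensorSq : Type w := (T ⊗[k] T) ⧸ s.balanced

/-- The projection `T ⊗ T → T ⊗_B T`. -/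
def proj : T ⊗[k] T →ₗ[k] s.TensorSq := s.balanced.mkQ

theorem proj_balanced (b : B) (t t' : T) :
    s.proj ((s.tgt b * t) ⊗ₜ[k] t') = s.proj (t ⊗ₜ[k] (s.source b * t')) := by
  rw [← sub_eq_zero, ← map_sub]
  exact (Submodule.Quotient.mk_eq_zero _).2 (Submodule.subset_span ⟨b, t, t', rfl⟩)

/-- A linear map on `T ⊗ T` that respects the balancing relations factors through `T ⊗_B T`. -/
def desc {M : Type*} [AddCommGroup M] [Module k M] (f : T ⊗[k] T →ₗ[k] M)
    (hf : ∀ (b : B) (t t' : T), f ((s.tgt b * t) ⊗ₜ[k] t') = f (t ⊗ₜ[k] (s.source b * t'))) :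
    s.TensorSq →ₗ[k] M :=
  s.balanced.liftQ f (Submodule.span_le.2 (by
    rintro _ ⟨b, t, t', rfl⟩
    simp [hf]))

@[simp]
theorem desc_proj {M : Type*} [AddCommGroup M] [Module k M] (f : T ⊗[k] T →ₗ[k] M)
    (hf : ∀ (b : B) (t t' : T), f ((s.tgt b * t) ⊗ₜ[k] t') = f (t ⊗ₜ[k] (s.source b * t')))
    (x : T ⊗[k] T) : s.desc f hf (s.proj x) = f x := rfl

theorem hom_ext {M : Type*} [AddCommGroup M] [Module k M] {f g : s.TensorSq →ₗ[k] M}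
    (h : ∀ t t' : T, f (s.proj (t ⊗ₜ[k] t')) = g (s.proj (t ⊗ₜ[k] t'))) : f = g :=
  Submodule.linearMap_qext _ (TensorProduct.ext' h)

/-- The left action of `B` on `T ⊗_B T`: `b · (t ⊗ t') = source b * t ⊗ t'`. -/
def leftAct (b : B) : s.TensorSq →ₗ[k] s.TensorSq :=
  s.desc (s.proj ∘ₗ TensorProduct.map (LinearMap.mulLeft k (s.source b)) LinearMap.id) (by
    intro c t t'
    have h : s.source b * (s.tgt c * t) = s.tgt c * (s.source b * t) := by
      rw [← mul_assoc, s.source_mul_tgt, mul_assoc]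
    simpa [h] using s.proj_balanced c (s.source b * t) t')

/-- The right action of `B` on `T ⊗_B T`: `(t ⊗ t') · b = t ⊗ tgt b * t'`. -/
def rightAct (b : B) : s.TensorSq →ₗ[k] s.TensorSq :=
  s.desc (s.proj ∘ₗ TensorProduct.map LinearMap.id (LinearMap.mulLeft k (s.tgt b))) (by
    intro c t t'
    have h : s.tgt b * (s.source c * t') = s.source c * (s.tgt b * t') := by
      rw [← mul_assoc, ← s.source_mul_tgt, mul_assoc]
    simpa [h] using s.proj_balanced c t (s.tgt b * t'))

/-- Right multiplication on `T ⊗_B T` by `r ⊗ r' ∈ T ⊗ T`: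
`(t ⊗ t') (r ⊗ r') = t * r ⊗ t' * r'`. -/
def rightMul (r r' : T) : s.TensorSq →ₗ[k] s.TensorSq :=
  s.desc (s.proj ∘ₗ TensorProduct.map (LinearMap.mulRight k r) (LinearMap.mulRight k r')) (by
    intro c t t'
    simpa [mul_assoc] using s.proj_balanced c (t * r) (t' * r'))

@[simp]
theorem leftAct_tmul (b : B) (t t' : T) :
    s.leftAct b (s.proj (t ⊗ₜ[k] t')) = s.proj ((s.source b * t) ⊗ₜ[k] t') := rfl

@[simp]
theorem rightAct_tmul (b : B) (t t' : T) :
    s.rightAct b (s.proj (t ⊗ₜ[k] t')) = s.proj (t ⊗ₜ[k] (s.tgt b * t')) := rfl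

@[simp]
theorem rightMul_tmul (r r' t t' : T) :
    s.rightMul r r' (s.proj (t ⊗ₜ[k] t')) = s.proj ((t * r) ⊗ₜ[k] (t' * r')) := rfl

/-- The right action of `T ⊗ T` on `T ⊗_B T`, extended linearly. -/
def rightMulHom : Tᵐᵒᵖ ⊗[k] Tᵐᵒᵖ →ₗ[k] s.TensorSq →ₗ[k] s.TensorSq :=
  TensorProduct.lift (LinearMap.mk₂ k (fun r r' => s.rightMul (unop r) (unop r'))
    (fun a b c => s.hom_ext fun t t' => by simp [mul_add, TensorProduct.add_tmul])
    (fun a b c => s.hom_ext fun t t' => by simp [← TensorProduct.smul_tmul'])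
    (fun a b c => s.hom_ext fun t t' => by simp [mul_add, TensorProduct.tmul_add])
    (fun a b c => s.hom_ext fun t t' => by simp))

/-- The map `φ : T ⊗ T ⊗ T → T ⊗_B T`, `t ⊗ t' ⊗ t'' ↦ Δ(t) (t' ⊗ t'')`, for a linear map
`Δ : T → T ⊗_B T`. Its domain is written as the algebra `T ⊗ Tᵒᵖ ⊗ Tᵒᵖ`. -/
def phi (Δ : T →ₗ[k] s.TensorSq) : T ⊗[k] (Tᵐᵒᵖ ⊗[k] Tᵐᵒᵖ) →ₗ[k] s.TensorSq :=
  TensorProduct.lift (s.rightMulHom.flip ∘ₗ Δ)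

/-- The subspace of `T ⊗ T ⊗ T` by which one divides to get `T ⊗_B T ⊗_B T`. -/
def balanced₃ : Submodule k (T ⊗[k] (T ⊗[k] T)) :=
  Submodule.span k
    ({z | ∃ (b : B) (t t' t'' : T),
      z = (s.tgt b * t) ⊗ₜ[k] (t' ⊗ₜ[k] t'') - t ⊗ₜ[k] ((s.source b * t') ⊗ₜ[k] t'')} ∪
    {z | ∃ (b : B) (t t' t'' : T),
      z = t ⊗ₜ[k] ((s.tgt b * t') ⊗ₜ[k] t'') - t ⊗ₜ[k] (t' ⊗ₜ[k] (s.source b * t''))})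

/-- The tensor product `T ⊗_B T ⊗_B T`. -/
abbrev TensorCube : Type w := (T ⊗[k] (T ⊗[k] T)) ⧸ s.balanced₃

/-- The projection `T ⊗ T ⊗ T → T ⊗_B T ⊗_B T`. -/
def proj₃ : T ⊗[k] (T ⊗[k] T) →ₗ[k] s.TensorCube := s.balanced₃.mkQ

theorem proj₃_balanced_left (b : B) (t t' t'' : T) :
    s.proj₃ ((s.tgt b * t) ⊗ₜ[k] (t' ⊗ₜ[k] t'')) =
      s.proj₃ (t ⊗ₜ[k] ((s.source b * t') ⊗ₜ[k] t'')) := by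
  rw [← sub_eq_zero, ← map_sub]
  exact (Submodule.Quotient.mk_eq_zero _).2 (Submodule.subset_span (Or.inl ⟨b, t, t', t'', rfl⟩))

theorem proj₃_balanced_right (b : B) (t t' t'' : T) :
    s.proj₃ (t ⊗ₜ[k] ((s.tgt b * t') ⊗ₜ[k] t'')) =
      s.proj₃ (t ⊗ₜ[k] (t' ⊗ₜ[k] (s.source b * t''))) := by
  rw [← sub_eq_zero, ← map_sub]
  exact (Submodule.Quotient.mk_eq_zero _).2 (Submodule.subset_span (Or.inr ⟨b, t, t', t'', rfl⟩))

/-- `(t ⊗ t') ↦ t ⊗ t' ⊗ t''` as a map `T ⊗_B T → T ⊗_B T ⊗_B T`. -/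
def appendRight (t'' : T) : s.TensorSq →ₗ[k] s.TensorCube :=
  s.desc (s.proj₃ ∘ₗ (TensorProduct.assoc k T T T).toLinearMap ∘ₗ
      (TensorProduct.mk k (T ⊗[k] T) T).flip t'')
    (fun b t t' => by simpa using s.proj₃_balanced_left b t t' t'')

/-- `(t' ⊗ t'') ↦ t ⊗ t' ⊗ t''` as a map `T ⊗_B T → T ⊗_B T ⊗_B T`. -/
def appendLeft (t : T) : s.TensorSq →ₗ[k] s.TensorCube :=
  s.desc (s.proj₃ ∘ₗ TensorProduct.mk k T (T ⊗[k] T) t)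
    (fun b t' t'' => by simpa using s.proj₃_balanced_right b t t' t'')

@[simp]
theorem appendRight_tmul (t t' t'' : T) :
    s.appendRight t'' (s.proj (t ⊗ₜ[k] t')) = s.proj₃ (t ⊗ₜ[k] (t' ⊗ₜ[k] t'')) := rfl

@[simp]
theorem appendLeft_tmul (t t' t'' : T) :
    s.appendLeft t (s.proj (t' ⊗ₜ[k] t'')) = s.proj₃ (t ⊗ₜ[k] (t' ⊗ₜ[k] t'')) := rfl

theorem appendRight_rightAct (b : B) (x : s.TensorSq) (t'' : T) :
    s.appendRight t'' (s.rightAct b x) = s.appendRight (s.source b * t'') x := by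
  have h : s.appendRight t'' ∘ₗ s.rightAct b = s.appendRight (s.source b * t'') :=
    s.hom_ext fun t t' => by simpa using s.proj₃_balanced_right b t t' t''
  exact LinearMap.congr_fun h x

theorem appendLeft_leftAct (b : B) (x : s.TensorSq) (t : T) :
    s.appendLeft t (s.leftAct b x) = s.appendLeft (s.tgt b * t) x := by
  have h : s.appendLeft t ∘ₗ s.leftAct b = s.appendLeft (s.tgt b * t) :=
    s.hom_ext fun t' t'' => by simpa using (s.proj₃_balanced_left b t t' t'').symm
  exact LinearMap.congr_fun h x

/-- `Δ ⊗_B id : T ⊗_B T → T ⊗_B T ⊗_B T` for a map `Δ` of right `B`-modules. -/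
def comulTensorId (Δ : T →ₗ[k] s.TensorSq)
    (hΔ : ∀ (b : B) (t : T), Δ (s.tgt b * t) = s.rightAct b (Δ t)) :
    s.TensorSq →ₗ[k] s.TensorCube :=
  s.desc (TensorProduct.lift (LinearMap.mk₂ k (fun t t'' => s.appendRight t'' (Δ t))
      (by simp) (by simp)
      (fun t a b => by
        have h : s.appendRight (a + b) = s.appendRight a + s.appendRight b :=
          s.hom_ext fun t t' => by simp [TensorProduct.tmul_add]
        simp [h])
      (fun c t a => by
        have h : s.appendRight (c • a) = c • s.appendRight a :=
          s.hom_ext fun t t' => by simp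
        simp [h])))
    (fun b t t' => by simp [hΔ, appendRight_rightAct])

/-- `id ⊗_B Δ : T ⊗_B T → T ⊗_B T ⊗_B T` for a map `Δ` of left `B`-modules. -/
def idTensorComul (Δ : T →ₗ[k] s.TensorSq)
    (hΔ : ∀ (b : B) (t : T), Δ (s.source b * t) = s.leftAct b (Δ t)) :
    s.TensorSq →ₗ[k] s.TensorCube :=
  s.desc (TensorProduct.lift (LinearMap.mk₂ k (fun t t' => s.appendLeft t (Δ t'))
      (fun a b t => by
        have h : s.appendLeft (a + b) = s.appendLeft a + s.appendLeft b :=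
          s.hom_ext fun t t' => by simp [TensorProduct.add_tmul]
        simp [h])
      (fun c a t => by
        have h : s.appendLeft (c • a) = c • s.appendLeft a :=
          s.hom_ext fun t t' => by simp [← TensorProduct.smul_tmul']
        simp [h])
      (by simp) (by simp)))
    (fun b t t' => by simp [hΔ, appendLeft_leftAct])

/-- `λ (ε ⊗ id) : T ⊗_B T → T`, `t ⊗ t' ↦ source (ε t) * t'`. -/
def counitTensorId (ε : T →ₗ[k] B) (hε : ∀ (b : B) (t : T), ε (s.tgt b * t) = ε t * b) :
    s.TensorSq →ₗ[k] T :=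
  s.desc (LinearMap.mul' k T ∘ₗ TensorProduct.map (s.source.toLinearMap ∘ₗ ε) LinearMap.id)
    (fun b t t' => by simp [hε, mul_assoc])

/-- `ρ (id ⊗ ε) : T ⊗_B T → T`, `t ⊗ t' ↦ tgt (ε t') * t`. -/
def idTensorCounit (ε : T →ₗ[k] B) (hε : ∀ (b : B) (t : T), ε (s.source b * t) = b * ε t) :
    s.TensorSq →ₗ[k] T :=
  s.desc (LinearMap.mul' k T ∘ₗ TensorProduct.map (s.tgt ∘ₗ ε) LinearMap.id ∘ₗ
      (TensorProduct.comm k T T).toLinearMap)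
    (fun b t t' => by simp [hε, tgt_mul, mul_assoc])

/-- `m (τ ⊗ id) : T ⊗_B T → T`, `t ⊗ t' ↦ τ(t) * t'`, for an anti-multiplicative `τ` with
`τ ∘ tgt = source`. -/
def antipodeMulId (τ : T →ₗ[k] T) (hmul : ∀ x y : T, τ (x * y) = τ y * τ x)
    (hτ : ∀ b : B, τ (s.tgt b) = s.source b) : s.TensorSq →ₗ[k] T :=
  s.desc (LinearMap.mul' k T ∘ₗ TensorProduct.map τ LinearMap.id)
    (fun b t t' => by simp [hmul, hτ, mul_assoc])

end SourceTarget

/-- A bialgebroid over the base algebra `B` with total algebra `T`. -/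
structure Bialgebroid (k : Type u) (B : Type v) (T : Type w) [Field k] [Ring B] [Algebra k B]
    [Ring T] [Algebra k T] extends SourceTarget k B T where
  /-- The coproduct `T → T ⊗_B T`. -/
  comul : T →ₗ[k] toSourceTarget.TensorSq
  comul_left : ∀ (b : B) (t : T), comul (source b * t) = toSourceTarget.leftAct b (comul t)
  comul_right : ∀ (b : B) (t : T),
    comul (toSourceTarget.tgt b * t) = toSourceTarget.rightAct b (comul t)
  comul_one : comul 1 = toSourceTarget.proj (1 ⊗ₜ[k] 1)
  coassoc : toSourceTarget.comulTensorId comul comul_right ∘ₗ comul =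
    toSourceTarget.idTensorComul comul comul_left ∘ₗ comul
  /-- The kernel of `t ⊗ t' ⊗ t'' ↦ Δ(t) (t' ⊗ t'')` is a left ideal of `T ⊗ Tᵒᵖ ⊗ Tᵒᵖ`. -/
  ker_phi_leftIdeal : ∀ a x : T ⊗[k] (Tᵐᵒᵖ ⊗[k] Tᵐᵒᵖ),
    toSourceTarget.phi comul x = 0 → toSourceTarget.phi comul (a * x) = 0
  /-- The counit. -/
  counit : T →ₗ[k] B
  counit_left : ∀ (b : B) (t : T), counit (source b * t) = b * counit t
  counit_right : ∀ (b : B) (t : T), counit (toSourceTarget.tgt b * t) = counit t * b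
  counit_one : counit 1 = 1
  counit_tensor_id : toSourceTarget.counitTensorId counit counit_right ∘ₗ comul = LinearMap.id
  id_tensor_counit : toSourceTarget.idTensorCounit counit counit_left ∘ₗ comul = LinearMap.id
  /-- The kernel of the counit is a left ideal of `T`. -/
  ker_counit_leftIdeal : ∀ a t : T, counit t = 0 → counit (a * t) = 0

/-- A Hopf algebroid over `B` with total algebra `T`. -/
structure HopfAlgebroid (k : Type u) (B : Type v) (T : Type w) [Field k] [Ring B] [Algebra k B]
    [Ring T] [Algebra k T] extends Bialgebroid k B T where
  /-- The antipode, an algebra anti-isomorphism. -/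
  antipode : T →ₗ[k] T
  antipode_bijective : Function.Bijective antipode
  antipode_one : antipode 1 = 1
  antipode_mul : ∀ x y : T, antipode (x * y) = antipode y * antipode x
  antipode_tgt : ∀ b : B, antipode (toSourceTarget.tgt b) = source b
  /-- `m (τ ⊗ id) Δ = β ε τ`. -/
  antipode_mul_id : toSourceTarget.antipodeMulId antipode antipode_mul antipode_tgt ∘ₗ comul =
    toSourceTarget.tgt ∘ₗ counit ∘ₗ antipode
  /-- There is a linear section `γ` of `T ⊗ T → T ⊗_B T` with `m (id ⊗ τ) γ Δ = α ε`. -/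
  exists_section : ∃ γ : toSourceTarget.TensorSq →ₗ[k] T ⊗[k] T,
    toSourceTarget.proj ∘ₗ γ = LinearMap.id ∧
    LinearMap.mul' k T ∘ₗ TensorProduct.map LinearMap.id antipode ∘ₗ γ ∘ₗ comul =
      source.toLinearMap ∘ₗ counit

/-! ### Module algebras and smash products -/

section Action

variable (k : Type*) [Field k] {H K : Type*} [Ring H] [Algebra k H] [Ring K] [Algebra k K]
  (V W : Type*) [AddCommGroup V] [Module k V] [Module H V] [IsScalarTower k H V]
  [AddCommGroup W] [Module k W] [Module K W] [IsScalarTower k K W]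

/-- The action of `H ⊗ K` on `V ⊗ W`: `(h ⊗ h') · (v ⊗ w) = h v ⊗ h' w`. -/
def tensorAct : H ⊗[k] K →ₐ[k] Module.End k (V ⊗[k] W) :=
  (Module.endTensorEndAlgHom (R := k) (S := k) (A := k)).comp
    (Algebra.TensorProduct.map (Algebra.lsmul k k V) (Algebra.lsmul k k W))

@[simp]
theorem tensorAct_tmul (h : H) (h' : K) (v : V) (w : W) :
    tensorAct k V W (h ⊗ₜ[k] h') (v ⊗ₜ[k] w) = (h • v) ⊗ₜ[k] (h' • w) := rfl

end Action

/-- A left `H`-module algebra `V`: `h (v w) = ∑ (h₁ v) (h₂ w)` and `h 1 = ε(h) 1`. -/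
class ModuleAlgebra (k H V : Type*) [Field k] [Ring H] [Bialgebra k H] [Ring V] [Algebra k V]
    [Module H V] [IsScalarTower k H V] : Prop where
  smul_mul : ∀ (h : H) (v w : V), h • (v * w) =
    LinearMap.mul' k V (tensorAct k V V (Coalgebra.comul (R := k) h) (v ⊗ₜ[k] w))
  smul_one : ∀ h : H, h • (1 : V) = Coalgebra.counit (R := k) h • (1 : V)

/-- The underlying space `V ⊗ L` of the smash product `V # L`. -/
def SmashProduct (k V L : Type*) [Field k] [Ring V] [Algebra k V] [Ring L] [Algebra k L] :
    Type _ := V ⊗[k] L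

namespace SmashProduct

section Space

variable (k V L : Type*) [Field k] [Ring V] [Algebra k V] [Ring L] [Algebra k L]

instance : AddCommGroup (SmashProduct k V L) := inferInstanceAs (AddCommGroup (V ⊗[k] L))

instance : Module k (SmashProduct k V L) := inferInstanceAs (Module k (V ⊗[k] L))

/-- The identification of the underlying spaces. -/
def equiv : V ⊗[k] L ≃ₗ[k] SmashProduct k V L := LinearEquiv.refl k (V ⊗[k] L)

variable {V L}

/-- The element `v # l`. -/
def mk (v : V) (l : L) : SmashProduct k V L := equiv k V L (v ⊗ₜ[k] l)

variable (L) in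
/-- The map `l ↦ v # l`. -/
def mkHom (v : V) : L →ₗ[k] SmashProduct k V L :=
  (equiv k V L).toLinearMap ∘ₗ TensorProduct.mk k V L v

theorem mkHom_apply (v : V) (l : L) : mkHom k L v l = mk k v l := rfl

end Space

variable (k V L : Type*) [Field k] [Ring V] [Algebra k V] [Ring L] [Bialgebra k L]
  [Module L V] [IsScalarTower k L V]

/-- The operator `w ⊗ m ↦ v w ⊗ m`. -/
def leftOp : V →ₐ[k] Module.End k (V ⊗[k] L) :=
  (tensorAct k V L).comp (Algebra.TensorProduct.includeLeft (R := k) (S := k) (A := V) (B := L))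

/-- The operator `w ⊗ m ↦ ∑ l₁ w ⊗ l₂ m`. -/
def diagOp : L →ₐ[k] Module.End k (V ⊗[k] L) :=
  (tensorAct k V L).comp (Bialgebra.comulAlgHom k L)

/-- The multiplication of `V # L`: `(v # l) (w # m) = ∑ v (l₁ w) # l₂ m`. -/
def mulHom : V ⊗[k] L →ₗ[k] Module.End k (V ⊗[k] L) :=
  TensorProduct.lift ((LinearMap.mul k (Module.End k (V ⊗[k] L))).compl₁₂
    (leftOp k V L).toLinearMap (diagOp k V L).toLinearMap)

theorem mulHom_tmul (v : V) (l : L) :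
    mulHom k V L (v ⊗ₜ[k] l) = leftOp k V L v * diagOp k V L l := rfl

theorem mulHom_one : mulHom k V L (1 ⊗ₜ 1) = 1 := by
  rw [mulHom_tmul, map_one, map_one, one_mul]

variable [ModuleAlgebra k L V]

theorem diagOp_leftOp {ι : Type*} (l : L) (w : V) (r : Coalgebra.Repr k l ι) :
    diagOp k V L l * leftOp k V L w =
      ∑ i ∈ r.index, leftOp k V L (r.left i • w) * diagOp k V L (r.right i) := by
  refine TensorProduct.ext' fun u m => ?_
  let act (x : V) : L →ₗ[k] V := (Algebra.lsmul k k V).toLinearMap.flip x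
  let G : L ⊗[k] (L ⊗[k] L) →ₗ[k] V ⊗[k] L :=
    TensorProduct.map (LinearMap.mul' k V) LinearMap.id ∘ₗ
      (TensorProduct.assoc k V V L).symm.toLinearMap ∘ₗ
      TensorProduct.map (act w) (TensorProduct.map (act u) (LinearMap.mulRight k m))
  have hG (a b c : L) : G (a ⊗ₜ (b ⊗ₜ c)) = ((a • w) * (b • u)) ⊗ₜ (c * m) := rfl
  have key := congrArg G (Coalgebra.sum_tmul_tmul_eq r
    (fun i => Coalgebra.Repr.arbitrary k (r.left i))
    (fun i => Coalgebra.Repr.arbitrary k (r.right i)))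
  simp only [map_sum, hG] at key
  have hL : (diagOp k V L l * leftOp k V L w) (u ⊗ₜ m) =
      ∑ i ∈ r.index, (r.left i • (w * u)) ⊗ₜ[k] (r.right i * m) := by
    simp [leftOp, diagOp, ← r.eq, LinearMap.sum_apply]
  rw [hL]
  have h1 (i : ι) : r.left i • (w * u) =
      ∑ j ∈ (Coalgebra.Repr.arbitrary k (r.left i)).index,
        ((Coalgebra.Repr.arbitrary k (r.left i)).left j • w) *
          ((Coalgebra.Repr.arbitrary k (r.left i)).right j • u) := by
    rw [ModuleAlgebra.smul_mul (k := k), ← (Coalgebra.Repr.arbitrary k (r.left i)).eq]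
    simp [LinearMap.sum_apply]
  have h2 (i : ι) : (leftOp k V L (r.left i • w) * diagOp k V L (r.right i)) (u ⊗ₜ m) =
      ∑ j ∈ (Coalgebra.Repr.arbitrary k (r.right i)).index,
        ((r.left i • w) * ((Coalgebra.Repr.arbitrary k (r.right i)).left j • u)) ⊗ₜ[k]
          ((Coalgebra.Repr.arbitrary k (r.right i)).right j * m) := by
    have : diagOp k V L (r.right i) = tensorAct k V L (Coalgebra.comul (R := k) (r.right i)) := rfl
    rw [this, ← (Coalgebra.Repr.arbitrary k (r.right i)).eq]
    simp [leftOp, LinearMap.sum_apply]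
  rw [LinearMap.sum_apply, Finset.sum_congr rfl fun i _ => h2 i, ← key]
  refine Finset.sum_congr rfl fun i _ => ?_
  rw [h1 i, TensorProduct.sum_tmul]

theorem mulHom_mulHom (x y : V ⊗[k] L) :
    mulHom k V L (mulHom k V L x y) = mulHom k V L x * mulHom k V L y := by
  induction x with
  | zero => simp
  | add x₁ x₂ h₁ h₂ => simp [h₁, h₂, add_mul]
  | tmul v l =>
    induction y with
    | zero => simp
    | add y₁ y₂ h₁ h₂ => simp [h₁, h₂, mul_add]
    | tmul w m =>
      have h : mulHom k V L (v ⊗ₜ l) (w ⊗ₜ m) =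
          ∑ i ∈ (Coalgebra.Repr.arbitrary k l).index,
            (v * ((Coalgebra.Repr.arbitrary k l).left i • w)) ⊗ₜ[k]
              ((Coalgebra.Repr.arbitrary k l).right i * m) := by
        have : diagOp k V L l = tensorAct k V L (Coalgebra.comul (R := k) l) := rfl
        rw [mulHom_tmul, this, ← (Coalgebra.Repr.arbitrary k l).eq]
        simp [leftOp, LinearMap.sum_apply]
      rw [h, map_sum, mulHom_tmul, mulHom_tmul,
        show leftOp k V L v * diagOp k V L l * (leftOp k V L w * diagOp k V L m) =
          leftOp k V L v * (diagOp k V L l * leftOp k V L w) * diagOp k V L m by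
          simp only [mul_assoc],
        diagOp_leftOp k V L l w (Coalgebra.Repr.arbitrary k l), Finset.mul_sum, Finset.sum_mul]
      refine Finset.sum_congr rfl fun i _ => ?_
      rw [mulHom_tmul, map_mul, map_mul]
      simp only [mul_assoc]

theorem mulHom_apply_one (x : V ⊗[k] L) : mulHom k V L x (1 ⊗ₜ 1) = x := by
  induction x with
  | zero => simp
  | add x₁ x₂ h₁ h₂ => simp [h₁, h₂]
  | tmul v l =>
    have : diagOp k V L l = tensorAct k V L (Coalgebra.comul (R := k) l) := rfl
    rw [mulHom_tmul, this, ← (Coalgebra.Repr.arbitrary k l).eq]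
    have h := Coalgebra.sum_counit_smul (Coalgebra.Repr.arbitrary k l)
    simp only [leftOp, LinearMap.sum_apply, ModuleAlgebra.smul_one (k := k), map_sum,
      Module.End.mul_apply, tensorAct_tmul, TensorProduct.smul_tmul, smul_eq_mul, mul_one,
      AlgHom.comp_apply, Algebra.TensorProduct.includeLeft_apply, one_mul]
    rw [← TensorProduct.tmul_sum, h]

instance : Ring (SmashProduct k V L) :=
  { (inferInstance : AddCommGroup (SmashProduct k V L)) with
    mul := fun x y => equiv k V L (mulHom k V L ((equiv k V L).symm x) ((equiv k V L).symm y))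
    one := equiv k V L (1 ⊗ₜ 1)
    left_distrib := fun x y z => by
      change equiv k V L (mulHom k V L _ ((equiv k V L).symm (y + z))) = _
      rw [map_add, map_add, map_add]; rfl
    right_distrib := fun x y z => by
      change equiv k V L (mulHom k V L ((equiv k V L).symm (x + y)) _) = _
      rw [map_add, map_add, LinearMap.add_apply, map_add]; rfl
    zero_mul := fun x => by
      change equiv k V L (mulHom k V L ((equiv k V L).symm 0) _) = _
      rw [map_zero, map_zero, LinearMap.zero_apply, map_zero]
    mul_zero := fun x => by
      change equiv k V L (mulHom k V L _ ((equiv k V L).symm 0)) = _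
      rw [map_zero, map_zero, map_zero]
    mul_assoc := fun x y z => congrArg (equiv k V L)
      (LinearMap.congr_fun (mulHom_mulHom k V L ((equiv k V L).symm x) ((equiv k V L).symm y))
        ((equiv k V L).symm z))
    one_mul := fun x => congrArg (equiv k V L)
      (LinearMap.congr_fun (mulHom_one k V L) ((equiv k V L).symm x))
    mul_one := fun x => congrArg (equiv k V L) (mulHom_apply_one k V L ((equiv k V L).symm x)) }

theorem mul_def (x y : SmashProduct k V L) :
    x * y = equiv k V L (mulHom k V L ((equiv k V L).symm x) ((equiv k V L).symm y)) := rfl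

instance : Algebra k (SmashProduct k V L) :=
  Algebra.ofModule
    (fun r x y => by simp only [mul_def, map_smul, LinearMap.smul_apply])
    (fun r x y => by simp only [mul_def, map_smul])

theorem one_def : (1 : SmashProduct k V L) = mk k 1 1 := rfl

/-- The defining formula `(v # l) (w # m) = ∑ v (l₁ w) # l₂ m`. -/
theorem mk_mul_mk {ι : Type*} (v w : V) (l m : L) (r : Coalgebra.Repr k l ι) :
    mk k v l * mk k w m = ∑ i ∈ r.index, mk k (v * (r.left i • w)) (r.right i * m) := by
  have : diagOp k V L l = tensorAct k V L (Coalgebra.comul (R := k) l) := rfl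
  simp only [mul_def, mk, LinearEquiv.symm_apply_apply]
  rw [← map_sum, mulHom_tmul, this, ← r.eq]
  simp [leftOp, LinearMap.sum_apply]

end SmashProduct

/-! ### Hopf subalgebras -/

namespace Subalgebra

variable {k H : Type*} [Field k] [Ring H] [Bialgebra k H] (K : Subalgebra k H)

/-- The inclusion `K ⊗ K → H ⊗ H`. -/
def incl₂ : K ⊗[k] K →ₐ[k] H ⊗[k] H := Algebra.TensorProduct.map K.val K.val

theorem incl₂_tmul (x y : K) : K.incl₂ (x ⊗ₜ y) = (x : H) ⊗ₜ[k] (y : H) := rfl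

theorem incl₂_injective : Function.Injective K.incl₂ :=
  TensorProduct.map_injective_of_flat_flat K.val.toLinearMap K.val.toLinearMap
    Subtype.val_injective Subtype.val_injective

variable (hK : ∀ x ∈ K, Coalgebra.comul (R := k) x ∈ K.incl₂.range)

/-- The restriction of the comultiplication of `H` to a map `K → K ⊗ K`. -/
def restrictComul : K →ₗ[k] K ⊗[k] K :=
  (LinearEquiv.ofInjective K.incl₂.toLinearMap K.incl₂_injective).symm.toLinearMap ∘ₗ
    LinearMap.codRestrict (LinearMap.range K.incl₂.toLinearMap)
      (Coalgebra.comul (R := k) ∘ₗ K.val.toLinearMap) (fun x => hK x x.2)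

theorem incl₂_restrictComul (x : K) :
    K.incl₂ (K.restrictComul hK x) = Coalgebra.comul (R := k) (x : H) :=
  congrArg Subtype.val ((LinearEquiv.ofInjective K.incl₂.toLinearMap K.incl₂_injective).apply_symm_apply
    ⟨Coalgebra.comul (R := k) (x : H), hK x x.2⟩)

set_option synthInstance.maxHeartbeats 200000 in
/-- The coalgebra structure on a subalgebra with `Δ(K) ⊆ K ⊗ K`. -/
@[reducible]
def restrictCoalgebra : Coalgebra k K where
  comul := K.restrictComul hK
  counit := Coalgebra.counit (R := k) ∘ₗ K.val.toLinearMap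
  coassoc := by
    ext x
    apply TensorProduct.map_injective_of_flat_flat K.val.toLinearMap K.incl₂.toLinearMap
      Subtype.val_injective K.incl₂_injective
    have h1 (y : K ⊗[k] K) : TensorProduct.map K.val.toLinearMap K.incl₂.toLinearMap
        (TensorProduct.assoc k K K K ((K.restrictComul hK).rTensor K y)) =
        TensorProduct.assoc k H H H ((Coalgebra.comul (R := k)).rTensor H (K.incl₂ y)) := by
      induction y with
      | zero => simp
      | add a b ha hb => simp only [map_add, ha, hb]
      | tmul a b =>
        rw [incl₂_tmul, LinearMap.rTensor_tmul, LinearMap.rTensor_tmul,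
          ← incl₂_restrictComul K hK a]
        induction K.restrictComul hK a with
        | zero => simp
        | add a b ha hb => simp only [map_add, TensorProduct.add_tmul, ha, hb]
        | tmul c d => rfl
    have h2 (y : K ⊗[k] K) : TensorProduct.map K.val.toLinearMap K.incl₂.toLinearMap
        ((K.restrictComul hK).lTensor K y) =
        (Coalgebra.comul (R := k)).lTensor H (K.incl₂ y) := by
      induction y with
      | zero => simp
      | add a b ha hb => simp only [map_add, ha, hb]
      | tmul a b =>
        rw [incl₂_tmul, LinearMap.lTensor_tmul, LinearMap.lTensor_tmul,
          ← incl₂_restrictComul K hK b]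
        rfl
    simp only [LinearMap.comp_apply, LinearEquiv.coe_coe]
    rw [h1, h2, incl₂_restrictComul]
    exact Coalgebra.coassoc_apply _
  rTensor_counit_comp_comul := by
    ext x
    apply Module.Flat.lTensor_preserves_injective_linearMap (M := k) K.val.toLinearMap
      Subtype.val_injective
    have h (y : K ⊗[k] K) : K.val.toLinearMap.lTensor k
        ((Coalgebra.counit (R := k) ∘ₗ K.val.toLinearMap).rTensor K y) =
        (Coalgebra.counit (R := k)).rTensor H (K.incl₂ y) := by
      induction y with
      | zero => simp
      | add a b ha hb => simp only [map_add, ha, hb]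
      | tmul a b => rfl
    rw [LinearMap.comp_apply, h, incl₂_restrictComul, Coalgebra.rTensor_counit_comul]
    rfl
  lTensor_counit_comp_comul := by
    ext x
    apply Module.Flat.rTensor_preserves_injective_linearMap (M := k) K.val.toLinearMap
      Subtype.val_injective
    have h (y : K ⊗[k] K) : K.val.toLinearMap.rTensor k
        ((Coalgebra.counit (R := k) ∘ₗ K.val.toLinearMap).lTensor K y) =
        (Coalgebra.counit (R := k)).lTensor H (K.incl₂ y) := by
      induction y with
      | zero => simp
      | add a b ha hb => simp only [map_add, ha, hb]
      | tmul a b => rfl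
    rw [LinearMap.comp_apply, h, incl₂_restrictComul, Coalgebra.lTensor_counit_comul]
    rfl

/-- The bialgebra structure on a subalgebra with `Δ(K) ⊆ K ⊗ K`. -/
@[reducible]
def restrictBialgebra : Bialgebra k K :=
  letI := K.restrictCoalgebra hK
  Bialgebra.mk' k K
    (Bialgebra.counit_one (R := k) (A := H))
    (fun {a b} => Bialgebra.counit_mul (R := k) (a : H) (b : H))
    (K.incl₂_injective (by
      change K.incl₂ (K.restrictComul hK 1) = _
      rw [incl₂_restrictComul, map_one]; exact Bialgebra.comul_one))
    (fun {a b} => K.incl₂_injective (by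
      change K.incl₂ (K.restrictComul hK (a * b)) =
        K.incl₂ (K.restrictComul hK a * K.restrictComul hK b)
      rw [map_mul K.incl₂]
      simp only [incl₂_restrictComul]
      exact Bialgebra.comul_mul _ _))

end Subalgebra

/-- A Hopf subalgebra of `H`: a subalgebra `K` with `Δ(K) ⊆ K ⊗ K` and `S(K) ⊆ K`. -/
structure HopfSubalgebra (k H : Type*) [Field k] [Ring H] [HopfAlgebra k H] extends
    Subalgebra k H where
  comul_mem : ∀ x ∈ toSubalgebra, Coalgebra.comul (R := k) x ∈ toSubalgebra.incl₂.range
  antipode_mem : ∀ x ∈ toSubalgebra, HopfAlgebra.antipode k x ∈ toSubalgebra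

namespace HopfSubalgebra

variable {k H : Type*} [Field k] [Ring H] [HopfAlgebra k H]

instance : CoeSort (HopfSubalgebra k H) (Type _) := ⟨fun K => K.toSubalgebra⟩

instance (K : HopfSubalgebra k H) : Bialgebra k K :=
  K.toSubalgebra.restrictBialgebra K.comul_mem

theorem incl₂_comul (K : HopfSubalgebra k H) (x : K) :
    K.toSubalgebra.incl₂ (Coalgebra.comul (R := k) x) = Coalgebra.comul (R := k) (x : H) :=
  K.toSubalgebra.incl₂_restrictComul K.comul_mem x

theorem counit_coe (K : HopfSubalgebra k H) (x : K) :
    Coalgebra.counit (R := k) x = Coalgebra.counit (R := k) (x : H) := rfl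

/-- The restriction of the antipode. -/
def restrictAntipode (K : HopfSubalgebra k H) : K →ₗ[k] K where
  toFun x := ⟨HopfAlgebra.antipode k (x : H), K.antipode_mem x x.2⟩
  map_add' x y := Subtype.ext (map_add (HopfAlgebra.antipode k) (x : H) (y : H))
  map_smul' c x := Subtype.ext (map_smul (HopfAlgebra.antipode k) c (x : H))

instance (K : HopfSubalgebra k H) : HopfAlgebra k K where
  antipode := K.restrictAntipode
  mul_antipode_rTensor_comul := by
    ext x
    have h (y : K ⊗[k] K) : ((LinearMap.mul' k K
        (K.restrictAntipode.rTensor K y) : K) : H)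
        = LinearMap.mul' k H ((HopfAlgebra.antipode k).rTensor H (K.toSubalgebra.incl₂ y)) := by
      induction y with
      | zero => simp
      | add a b ha hb => simp only [map_add, Subalgebra.coe_add, ha, hb]
      | tmul a b => rfl
    simp only [LinearMap.comp_apply]
    rw [h, incl₂_comul, HopfAlgebra.mul_antipode_rTensor_comul_apply]
    rfl
  mul_antipode_lTensor_comul := by
    ext x
    have h (y : K ⊗[k] K) : ((LinearMap.mul' k K
        (K.restrictAntipode.lTensor K y) : K) : H)
        = LinearMap.mul' k H ((HopfAlgebra.antipode k).lTensor H (K.toSubalgebra.incl₂ y)) := by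
      induction y with
      | zero => simp
      | add a b ha hb => simp only [map_add, Subalgebra.coe_add, ha, hb]
      | tmul a b => rfl
    simp only [LinearMap.comp_apply]
    rw [h, incl₂_comul, HopfAlgebra.mul_antipode_lTensor_comul_apply]
    rfl

theorem antipode_coe (K : HopfSubalgebra k H) (x : K) :
    ((HopfAlgebra.antipode k x : K) : H) = HopfAlgebra.antipode k (x : H) := rfl

end HopfSubalgebra

/-! ### Quasitriangular Hopf algebras -/

section RMatrix

variable (k : Type*) {H : Type*} [Field k] [Ring H] [Algebra k H]

/-- `a ⊗ b ↦ a ⊗ b ⊗ 1`. -/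
def leg12 : H ⊗[k] H →ₐ[k] H ⊗[k] (H ⊗[k] H) :=
  Algebra.TensorProduct.map (AlgHom.id k H) Algebra.TensorProduct.includeLeft

/-- `a ⊗ b ↦ a ⊗ 1 ⊗ b`. -/
def leg13 : H ⊗[k] H →ₐ[k] H ⊗[k] (H ⊗[k] H) :=
  Algebra.TensorProduct.map (AlgHom.id k H) Algebra.TensorProduct.includeRight

/-- `a ⊗ b ↦ 1 ⊗ a ⊗ b`. -/
def leg23 : H ⊗[k] H →ₐ[k] H ⊗[k] (H ⊗[k] H) := Algebra.TensorProduct.includeRight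

@[simp]
theorem leg12_tmul (a b : H) : leg12 k (a ⊗ₜ[k] b) = a ⊗ₜ[k] (b ⊗ₜ[k] 1) := rfl

@[simp]
theorem leg13_tmul (a b : H) : leg13 k (a ⊗ₜ[k] b) = a ⊗ₜ[k] (1 ⊗ₜ[k] b) := rfl

@[simp]
theorem leg23_tmul (a b : H) : leg23 k (a ⊗ₜ[k] b) = 1 ⊗ₜ[k] (a ⊗ₜ[k] b) := rfl

end RMatrix

/-- `R` is an `R`-matrix for `H`: it is invertible, `(Δ ⊗ id)(R) = R₁₃ R₂₃`,
`(id ⊗ Δ)(R) = R₁₃ R₁₂` and `Δᶜᵒᵖ(h) R = R Δ(h)`. A quasitriangular Hopf algebra is a Hopf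
algebra with an `R`-matrix. -/
structure IsRMatrix {k H : Type*} [Field k] [Ring H] [HopfAlgebra k H] (R : H ⊗[k] H) : Prop where
  isUnit : IsUnit R
  comul_id : TensorProduct.assoc k H H H ((Coalgebra.comul (R := k)).rTensor H R) =
    leg13 k R * leg23 k R
  id_comul : (Coalgebra.comul (R := k)).lTensor H R = leg13 k R * leg12 k R
  comul_op : ∀ h : H, TensorProduct.comm k H H (Coalgebra.comul (R := k) h) * R =
    R * Coalgebra.comul (R := k) h

/-- `id ⊗ p : H ⊗ H → H` for a linear form `p`. -/
def slice {k H : Type*} [Field k] [Ring H] [Algebra k H] (p : Module.Dual k H) :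
    H ⊗[k] H →ₗ[k] H :=
  (TensorProduct.rid k H).toLinearMap ∘ₗ p.lTensor H

@[simp]
theorem slice_tmul {k H : Type*} [Field k] [Ring H] [Algebra k H] (p : Module.Dual k H)
    (a b : H) : slice p (a ⊗ₜ[k] b) = p b • a := by
  simp [slice]

namespace IsRMatrix

variable {k H : Type*} [Field k] [Ring H] [HopfAlgebra k H] {R : H ⊗[k] H} 

theorem slice_counit (hR : IsRMatrix R) : slice (Coalgebra.counit (R := k)) R = 1 := by
  let F : H ⊗[k] (H ⊗[k] H) →ₐ[k] H ⊗[k] H :=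
    Algebra.TensorProduct.map (AlgHom.id k H)
      ((Algebra.TensorProduct.lid k H).toAlgHom.comp
        (Algebra.TensorProduct.map (Bialgebra.counitAlgHom k H) (AlgHom.id k H)))
  have h1 (x : H ⊗[k] H) : F ((Coalgebra.comul (R := k)).lTensor H x) = x := by
    induction x with
    | zero => simp
    | add a b ha hb => simp only [map_add, ha, hb]
    | tmul a b =>
      have h := Coalgebra.rTensor_counit_comul (R := k) b
      have h' : F (a ⊗ₜ Coalgebra.comul (R := k) b) = a ⊗ₜ[k] (TensorProduct.lid k H
          ((Coalgebra.counit (R := k)).rTensor H (Coalgebra.comul (R := k) b))) := rfl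
      rw [LinearMap.lTensor_tmul, h', h]
      simp
  have h2 (x : H ⊗[k] H) : F (leg13 k x) = x := by
    induction x with
    | zero => simp
    | add a b ha hb => simp only [map_add, ha, hb]
    | tmul a b => simp [F]
  have h3 (x : H ⊗[k] H) : F (leg12 k x) = slice (Coalgebra.counit (R := k)) x ⊗ₜ[k] 1 := by
    induction x with
    | zero => simp
    | add a b ha hb => simp only [map_add, ha, hb, TensorProduct.add_tmul]
    | tmul a b => simp [F, TensorProduct.smul_tmul]
  have h4 := congrArg F hR.id_comul
  rw [h1, map_mul F, h2, h3] at h4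
  have h5 : (1 : H ⊗[k] H) = slice (Coalgebra.counit (R := k)) R ⊗ₜ[k] 1 :=
    hR.isUnit.mul_left_cancel (by rw [mul_one]; exact h4)
  have h6 := congrArg (slice (Coalgebra.counit (R := k))) h5
  rw [Algebra.TensorProduct.one_def] at h6
  simpa using h6.symm

theorem slice_mul_slice (hR : IsRMatrix R) (p q : Module.Dual k H) :
    slice p R * slice q R = slice (LinearMap.mul' k k ∘ₗ TensorProduct.map q p ∘ₗ
      Coalgebra.comul (R := k)) R := by
  let G : H ⊗[k] (H ⊗[k] H) →ₗ[k] H :=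
    (TensorProduct.rid k H).toLinearMap ∘ₗ
      (LinearMap.mul' k k ∘ₗ TensorProduct.map q p).lTensor H
  have h1 (x : H ⊗[k] H) : G ((Coalgebra.comul (R := k)).lTensor H x) =
      slice (LinearMap.mul' k k ∘ₗ TensorProduct.map q p ∘ₗ Coalgebra.comul (R := k)) x := by
    induction x with
    | zero => simp
    | add a b ha hb => simp only [map_add, ha, hb]
    | tmul a b => simp [G]
  have h2 (x y : H ⊗[k] H) : G (leg13 k x * leg12 k y) = slice p x * slice q y := by
    induction x with
    | zero => simp
    | add a b ha hb => simp only [map_add, add_mul, ha, hb]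
    | tmul a b =>
      induction y with
      | zero => simp
      | add c d hc hd => simp only [map_add, mul_add, hc, hd]
      | tmul c d => simp [G, mul_smul]
  rw [← h1, hR.id_comul, h2]

/-- The subalgebra `R₍ₗ₎ = {(id ⊗ p)(R) | p ∈ H*}` of `H`. -/
def leftSubalgebra (hR : IsRMatrix R) : Subalgebra k H where
  carrier := {x | ∃ p : Module.Dual k H, slice p R = x}
  mul_mem' := by
    rintro _ _ ⟨p, rfl⟩ ⟨q, rfl⟩
    exact ⟨_, (hR.slice_mul_slice p q).symm⟩
  add_mem' := by
    rintro _ _ ⟨p, rfl⟩ ⟨q, rfl⟩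
    exact ⟨p + q, by simp [slice, LinearMap.lTensor_add]⟩
  algebraMap_mem' := fun c => ⟨c • Coalgebra.counit (R := k), by
    rw [Algebra.algebraMap_eq_smul_one, ← hR.slice_counit]
    simp [slice, LinearMap.lTensor_smul]⟩

theorem mem_leftSubalgebra (hR : IsRMatrix R) {x : H} :
    x ∈ hR.leftSubalgebra ↔ ∃ p : Module.Dual k H, slice p R = x := Iff.rfl

/-- `R` lies in the image of `R₍ₗ₎ ⊗ H`. -/
theorem exists_lift (hR : IsRMatrix R) : ∃ R' : hR.leftSubalgebra ⊗[k] H,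
    hR.leftSubalgebra.val.toLinearMap.rTensor H R' = R := by
  classical
  let b := Module.Basis.ofVectorSpace k H
  obtain ⟨c, hc⟩ := TensorProduct.eq_repr_basis_right b R
  have hmem (i) : c i ∈ hR.leftSubalgebra := by
    refine ⟨b.coord i, ?_⟩
    conv_lhs => rw [← hc]
    rw [Finsupp.sum, map_sum]
    simp only [slice_tmul, Module.Basis.coord_apply, Module.Basis.repr_self, Finsupp.single_apply,
      ite_smul, one_smul, zero_smul]
    rw [Finset.sum_ite_eq' c.support i c]
    simp +contextual [eq_comm]
  refine ⟨∑ i ∈ c.support, (⟨c i, hmem i⟩ : hR.leftSubalgebra) ⊗ₜ[k] b i, ?_⟩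
  rw [map_sum]
  exact hc

instance finite_leftSubalgebra (hR : IsRMatrix R) : FiniteDimensional k hR.leftSubalgebra := by
  classical
  obtain ⟨S, hS⟩ := TensorProduct.exists_finset R
  have h : Subalgebra.toSubmodule hR.leftSubalgebra ≤
      Submodule.span k ((S.image Prod.fst : Finset H) : Set H) := by
    rintro _ ⟨p, rfl⟩
    rw [hS, map_sum]
    refine Submodule.sum_mem _ fun i hi => ?_
    rw [slice_tmul]
    exact Submodule.smul_mem _ _ (Submodule.subset_span (by simpa using ⟨i.2, hi⟩))
  exact Submodule.finiteDimensional_of_le h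

theorem comul_mem (hR : IsRMatrix R) : ∀ x ∈ hR.leftSubalgebra,
    Coalgebra.comul (R := k) x ∈ hR.leftSubalgebra.incl₂.range := by
  rintro _ ⟨p, rfl⟩
  obtain ⟨R', hR'⟩ := hR.exists_lift
  let G : H ⊗[k] (H ⊗[k] H) →ₗ[k] H ⊗[k] H := (slice p).lTensor H
  have h1 (x : H ⊗[k] H) : G (TensorProduct.assoc k H H H
      ((Coalgebra.comul (R := k)).rTensor H x)) = Coalgebra.comul (R := k) (slice p x) := by
    induction x with
    | zero => simp
    | add a b ha hb => simp only [map_add, ha, hb]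
    | tmul a b =>
      rw [slice_tmul, map_smul, LinearMap.rTensor_tmul]
      induction Coalgebra.comul (R := k) a with
      | zero => simp
      | add a b ha hb => simp only [map_add, TensorProduct.add_tmul, smul_add, ha, hb]
      | tmul c d => simp [G]
  have h2 (x y : hR.leftSubalgebra ⊗[k] H) :
      G (leg13 k (hR.leftSubalgebra.val.toLinearMap.rTensor H x) *
        leg23 k (hR.leftSubalgebra.val.toLinearMap.rTensor H y)) ∈
        hR.leftSubalgebra.incl₂.range := by
    induction x with
    | zero => simp
    | add a b ha hb =>
      rw [map_add, map_add, add_mul, map_add]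
      exact add_mem ha hb
    | tmul a b =>
      induction y with
      | zero => simp
      | add c d hc hd =>
        rw [map_add, map_add, mul_add, map_add]
        exact add_mem hc hd
      | tmul c d =>
        refine ⟨p (b * d) • (a ⊗ₜ c), ?_⟩
        simp [G, Subalgebra.incl₂]
  have h3 := h2 R' R'
  rw [hR'] at h3
  rw [← h1, hR.comul_id]
  exact h3

end IsRMatrix

/-- A finite dimensional subalgebra `K` with `Δ(K) ⊆ K ⊗ K` is stable under the antipode. -/
theorem Subalgebra.antipode_mem_of_finite {k H : Type*} [Field k] [Ring H] [HopfAlgebra k H]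
    (K : Subalgebra k H) [FiniteDimensional k K]
    (hK : ∀ x ∈ K, Coalgebra.comul (R := k) x ∈ K.incl₂.range) :
    ∀ x ∈ K, HopfAlgebra.antipode k x ∈ K := by
  let _ : Bialgebra k K := K.restrictBialgebra hK
  let i : WithConv (K →ₗ[k] H) := WithConv.toConv K.val.toLinearMap
  let j : WithConv (K →ₗ[k] H) :=
    WithConv.toConv (HopfAlgebra.antipode k ∘ₗ K.val.toLinearMap)
  have hΔ (x : K) : K.incl₂ (Coalgebra.comul (R := k) x) = Coalgebra.comul (R := k) (x : H) :=
    K.incl₂_restrictComul hK x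
  have hji : j * i = 1 := by
    refine WithConv.ofConv_injective (LinearMap.ext fun x => ?_)
    have h (y : K ⊗[k] K) : LinearMap.mul' k H (TensorProduct.map j.ofConv i.ofConv y) =
        LinearMap.mul' k H ((HopfAlgebra.antipode k).rTensor H (K.incl₂ y)) := by
      induction y with
      | zero => simp
      | add a b ha hb => simp only [map_add, ha, hb]
      | tmul a b => rfl
    change LinearMap.mul' k H (TensorProduct.map j.ofConv i.ofConv (Coalgebra.comul x)) = _
    rw [h, hΔ, HopfAlgebra.mul_antipode_rTensor_comul_apply]
    rfl
  have hij : i * j = 1 := by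
    refine WithConv.ofConv_injective (LinearMap.ext fun x => ?_)
    have h (y : K ⊗[k] K) : LinearMap.mul' k H (TensorProduct.map i.ofConv j.ofConv y) =
        LinearMap.mul' k H ((HopfAlgebra.antipode k).lTensor H (K.incl₂ y)) := by
      induction y with
      | zero => simp
      | add a b ha hb => simp only [map_add, ha, hb]
      | tmul a b => rfl
    change LinearMap.mul' k H (TensorProduct.map i.ofConv j.ofConv (Coalgebra.comul x)) = _
    rw [h, hΔ, HopfAlgebra.mul_antipode_lTensor_comul_apply]
    rfl
  let Θ : (K →ₗ[k] K) →ₗ[k] (K →ₗ[k] K) :=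
    { toFun := fun f => LinearMap.mul' k K ∘ₗ f.lTensor K ∘ₗ Coalgebra.comul
      map_add' := fun f g => by
        simp [LinearMap.lTensor_add, LinearMap.add_comp, LinearMap.comp_add]
      map_smul' := fun c f => by
        simp [LinearMap.lTensor_smul, LinearMap.smul_comp, LinearMap.comp_smul] }
  have hΘ (f : K →ₗ[k] K) : WithConv.toConv (K.val.toLinearMap ∘ₗ Θ f) =
      i * WithConv.toConv (K.val.toLinearMap ∘ₗ f) := by
    refine WithConv.ofConv_injective (LinearMap.ext fun x => ?_)
    have h (y : K ⊗[k] K) : K.val (LinearMap.mul' k K (f.lTensor K y)) =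
        LinearMap.mul' k H (TensorProduct.map K.val.toLinearMap (K.val.toLinearMap ∘ₗ f) y) := by
      induction y with
      | zero => simp
      | add a b ha hb => simp only [map_add, ha, hb]
      | tmul a b => rfl
    exact h _
  have hinj : Function.Injective Θ := by
    intro f g hfg
    have h := congrArg (fun e => j * WithConv.toConv (K.val.toLinearMap ∘ₗ e)) hfg
    simp only [hΘ, ← mul_assoc, hji, one_mul] at h
    refine LinearMap.ext fun x => Subtype.ext ?_
    exact LinearMap.congr_fun (WithConv.toConv_injective h) x
  obtain ⟨f, hf⟩ := (LinearMap.injective_iff_surjective.1 hinj)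
    (Algebra.linearMap k K ∘ₗ Coalgebra.counit)
  have h1 : i * WithConv.toConv (K.val.toLinearMap ∘ₗ f) = 1 := by
    rw [← hΘ, hf]
    rfl
  have h2 : WithConv.toConv (K.val.toLinearMap ∘ₗ f) = j := (left_inv_eq_right_inv hji h1).symm
  intro x hx
  have h3 := LinearMap.congr_fun (WithConv.toConv_injective h2) ⟨x, hx⟩
  have h4 : HopfAlgebra.antipode k x = (f ⟨x, hx⟩ : H) := h3.symm
  rw [h4]
  exact (f ⟨x, hx⟩).2

namespace IsRMatrix

variable {k H : Type*} [Field k] [Ring H] [HopfAlgebra k H] {R : H ⊗[k] H}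

/-- The Hopf subalgebra `R₍ₗ₎ = {(id ⊗ p)(R) | p ∈ H*}` of `H`. -/
def leftHopfSubalgebra (hR : IsRMatrix R) : HopfSubalgebra k H where
  toSubalgebra := hR.leftSubalgebra
  comul_mem := hR.comul_mem
  antipode_mem := hR.leftSubalgebra.antipode_mem_of_finite hR.comul_mem

theorem mem_leftHopfSubalgebra (hR : IsRMatrix R) {x : H} :
    x ∈ hR.leftHopfSubalgebra.toSubalgebra ↔ ∃ p : Module.Dual k H, slice p R = x := Iff.rfl

end IsRMatrix

/-- The restriction of the action of `H` makes an `H`-module algebra a `K`-module algebra, for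
every Hopf subalgebra `K`. -/
instance HopfSubalgebra.moduleAlgebra {k H V : Type*} [Field k] [Ring H] [HopfAlgebra k H]
    [Ring V] [Algebra k V] [Module H V] [IsScalarTower k H V] [ModuleAlgebra k H V]
    (K : HopfSubalgebra k H) : ModuleAlgebra k K V where
  smul_mul l v w := by
    have h (y : K ⊗[k] K) : tensorAct k V V y (v ⊗ₜ w) =
        tensorAct k V V (K.toSubalgebra.incl₂ y) (v ⊗ₜ w) := by
      induction y with
      | zero => simp
      | add a b ha hb => simp only [map_add, LinearMap.add_apply, ha, hb]
      | tmul a b => rfl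
    rw [h, K.incl₂_comul]
    exact ModuleAlgebra.smul_mul (l : H) v w
  smul_one l := ModuleAlgebra.smul_one (k := k) (l : H)

/-- The inclusion `V # K → V ⊗ H`, `v # l ↦ v ⊗ l`, for a Hopf subalgebra `K` of `H`. -/
def SmashProduct.incl {k H : Type*} (V : Type*) [Field k] [Ring H] [HopfAlgebra k H]
    [Ring V] [Algebra k V] (K : HopfSubalgebra k H) : SmashProduct k V K →ₗ[k] V ⊗[k] H :=
  K.toSubalgebra.val.toLinearMap.lTensor V ∘ₗ (SmashProduct.equiv k V K).symm.toLinearMap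

theorem SmashProduct.incl_mk {k H V : Type*} [Field k] [Ring H] [HopfAlgebra k H]
    [Ring V] [Algebra k V] (K : HopfSubalgebra k H) (v : V) (l : K) :
    SmashProduct.incl V K (SmashProduct.mk k v l) = v ⊗ₜ[k] (l : H) := rfl

theorem SmashProduct.incl_injective {k H V : Type*} [Field k] [Ring H] [HopfAlgebra k H]
    [Ring V] [Algebra k V] (K : HopfSubalgebra k H) :
    Function.Injective (SmashProduct.incl (k := k) V K) :=
  (Module.Flat.lTensor_preserves_injective_linearMap (M := V) K.toSubalgebra.val.toLinearMap
    Subtype.val_injective).comp (SmashProduct.equiv k V K).symm.injective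

/-- An `H`-module algebra `V` is quantum commutative if `v w = ∑ (R² w) (R¹ v)`. -/
def IsQuantumCommutative {k H V : Type*} [Field k] [Ring H] [HopfAlgebra k H]
    [Ring V] [Algebra k V] [Module H V] [IsScalarTower k H V] (R : H ⊗[k] H) : Prop :=
  ∀ v w : V, v * w =
    LinearMap.mul' k V (TensorProduct.comm k V V (tensorAct k V V R (v ⊗ₜ[k] w)))

/-- The Drinfeld element `u = ∑ S(R²) R¹`. -/
def drinfeldElement {k H : Type*} [Field k] [Ring H] [HopfAlgebra k H] (R : H ⊗[k] H) : H :=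
  LinearMap.mul' k H ((HopfAlgebra.antipode k).rTensor H (TensorProduct.comm k H H R))

end

noncomputable section

universe u v w

open scoped Coalgebra

/-! Write T = V # L, with embeddings α : V → T and j : L → T, and β(v) = ∑ α(R² v) j(R¹). Since R
lies in L ⊗ H, β takes values in T, and every axiom becomes an identity in T that comes from one
axiom of R. The hexagon (Δ ⊗ id)(R) = R₁₃R₂₃ and quantum commutativity give β(w)α(v) = α(v)β(w); the
other hexagon then makes β anti-multiplicative; Δᶜᵒᵖ R = R Δ gives the exchange rule j(l)β(v) = ∑
β(l₂ v) j(l₁). The coproduct lifts to an algebra map T → T ⊗ T, and the exchange rule shows that its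
image satisfies Takeuchi's condition Δ(t)(β(v) ⊗ 1) = Δ(t)(1 ⊗ α(v)) modulo the balancing relations;
this makes the kernel of φ a left ideal. The counit is t ↦ t · 1 for the action of T on V, in which
β(v) acts as right multiplication by v. For the antipode, put d = ∑ S²(R¹)R². Convolution arguments
show that d h = S²(h) d and that d is a two-sided inverse of S(u) = ∑ R¹S(R²); bijectivity of S is
not assumed. From this come τβ = α (`sum_antipode_mul_targetMap`) and the formula ∑ j(S²(R¹)) α(R²
v) = β(d v), which yields β(d(vw)) = β((dv)(dw)). Since β is injective, d acts on V by algebra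
endomorphisms. Hence v ↦ β(d v) and l ↦ j(S(l)) form a covariant pair into the opposite algebra of
T, and the universal property of the smash product produces τ as an anti-homomorphism. Finally τ²(v
# l) = d v # S²(l), so τ is bijective. -/

namespace IsRMatrix

/-! ### Inverse and antipode invariance of R -/

variable {k H : Type*} [Field k] [Ring H] [HopfAlgebra k H] {R : H ⊗[k] H}

/-- Applying ε to the first leg of (Δ ⊗ id)(R) = R₁₃R₂₃ gives R = (1 ⊗ r) R with r = ∑ ε(R¹)R², and
R can be cancelled. -/
theorem lid_rTensor_counit (hR : IsRMatrix R) :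
    TensorProduct.lid k H ((Coalgebra.counit (R := k)).rTensor H R) = 1 := by
  let F : H ⊗[k] (H ⊗[k] H) →ₐ[k] H ⊗[k] H :=
    (Algebra.TensorProduct.lid k (H ⊗[k] H)).toAlgHom.comp
      (Algebra.TensorProduct.map (Bialgebra.counitAlgHom k H) (AlgHom.id k (H ⊗[k] H)))
  have h1 (x : H ⊗[k] H) : F (TensorProduct.assoc k H H H
      ((Coalgebra.comul (R := k)).rTensor H x)) = x := by
    induction x with
    | zero => simp
    | add a b ha hb => simp only [map_add, ha, hb]
    | tmul a b =>
      have h' (y : H ⊗[k] H) : F (TensorProduct.assoc k H H H (y ⊗ₜ b)) =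
          TensorProduct.lid k H ((Coalgebra.counit (R := k)).rTensor H y) ⊗ₜ[k] b := by
        induction y with
        | zero => simp
        | add a b ha hb => simp only [map_add, TensorProduct.add_tmul, ha, hb]
        | tmul c d => simp [F, TensorProduct.smul_tmul']
      rw [LinearMap.rTensor_tmul, h', Coalgebra.rTensor_counit_comul]
      simp
  have h2 (x : H ⊗[k] H) : F (leg13 k x) =
      1 ⊗ₜ[k] TensorProduct.lid k H ((Coalgebra.counit (R := k)).rTensor H x) := by
    induction x with
    | zero => simp
    | add a b ha hb => simp only [map_add, ha, hb, TensorProduct.tmul_add]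
    | tmul a b => simp [F]
  have h3 (x : H ⊗[k] H) : F (leg23 k x) = x := by
    induction x with
    | zero => simp
    | add a b ha hb => simp only [map_add, ha, hb]
    | tmul a b => simp [F]
  have h4 := congrArg F hR.comul_id
  rw [h1, map_mul F, h2, h3] at h4
  have h5 : (1 : H ⊗[k] H) =
      1 ⊗ₜ[k] TensorProduct.lid k H ((Coalgebra.counit (R := k)).rTensor H R) :=
    hR.isUnit.mul_right_cancel (by rw [one_mul]; exact h4)
  have h6 := congrArg (TensorProduct.lid k H ∘ (Coalgebra.counit (R := k)).rTensor H) h5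
  rw [Algebra.TensorProduct.one_def] at h6
  simpa using h6.symm

/-- `(S ⊗ id)(R)` is a left inverse of `R`. -/
theorem rTensor_antipode_mul (hR : IsRMatrix R) :
    (HopfAlgebra.antipode k).rTensor H R * R = 1 := by
  -- Contracting the first two legs by m(S ⊗ id) turns (Δ ⊗ id)(R) into 1 ⊗ 1 and R₁₃R₂₃ into (S ⊗
  -- id)(R) · R.
  let G : H ⊗[k] (H ⊗[k] H) →ₗ[k] H ⊗[k] H :=
    (LinearMap.mul' k H ∘ₗ (HopfAlgebra.antipode k).rTensor H).rTensor H ∘ₗ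
      (TensorProduct.assoc k H H H).symm.toLinearMap
  have h1 (x : H ⊗[k] H) : G (TensorProduct.assoc k H H H
      ((Coalgebra.comul (R := k)).rTensor H x)) =
      1 ⊗ₜ[k] TensorProduct.lid k H ((Coalgebra.counit (R := k)).rTensor H x) := by
    induction x with
    | zero => simp
    | add a b ha hb => simp only [map_add, ha, hb, TensorProduct.tmul_add]
    | tmul a b =>
      simp [G, HopfAlgebra.mul_antipode_rTensor_comul_apply, Algebra.algebraMap_eq_smul_one,
        TensorProduct.smul_tmul]
  have h2 (x y : H ⊗[k] H) : G (leg13 k x * leg23 k y) =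
      (HopfAlgebra.antipode k).rTensor H x * y := by
    induction x with
    | zero => simp
    | add a b ha hb => simp only [map_add, add_mul, ha, hb]
    | tmul a b =>
      induction y with
      | zero => simp
      | add a b ha hb => simp only [map_add, mul_add, ha, hb]
      | tmul c d => simp [G]
  rw [← h2, ← hR.comul_id, h1, hR.lid_rTensor_counit, Algebra.TensorProduct.one_def]

theorem mul_rTensor_antipode (hR : IsRMatrix R) :
    R * (HopfAlgebra.antipode k).rTensor H R = 1 := by
  obtain ⟨r, rfl⟩ := hR.isUnit
  rw [Units.mul_eq_one_iff_inv_eq, Units.inv_eq_of_mul_eq_one_left hR.rTensor_antipode_mul]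

/-- `(S ⊗ S)(R) = R`. -/
theorem map_antipode_antipode (hR : IsRMatrix R) :
    TensorProduct.map (HopfAlgebra.antipode k) (HopfAlgebra.antipode k) R = R := by
  -- S ⊗ m(id ⊗ S) sends (id ⊗ Δ)(R) to 1 and R₁₃R₁₂ to (S ⊗ id)(R) · (S ⊗ S)(R). So (S ⊗ S)(R) is a
  -- right inverse of R⁻¹.
  let G : H ⊗[k] (H ⊗[k] H) →ₗ[k] H ⊗[k] H :=
    TensorProduct.map (HopfAlgebra.antipode k)
      (LinearMap.mul' k H ∘ₗ (HopfAlgebra.antipode k).lTensor H)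
  have h1 (x : H ⊗[k] H) : G ((Coalgebra.comul (R := k)).lTensor H x) =
      HopfAlgebra.antipode k (slice (Coalgebra.counit (R := k)) x) ⊗ₜ[k] 1 := by
    induction x with
    | zero => simp
    | add a b ha hb => simp only [map_add, ha, hb, TensorProduct.add_tmul]
    | tmul a b =>
      simp [G, HopfAlgebra.mul_antipode_lTensor_comul_apply, Algebra.algebraMap_eq_smul_one,
        TensorProduct.smul_tmul]
  have h2 (x y : H ⊗[k] H) : G (leg13 k x * leg12 k y) =
      (HopfAlgebra.antipode k).rTensor H y *
        TensorProduct.map (HopfAlgebra.antipode k) (HopfAlgebra.antipode k) x := by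
    induction x with
    | zero => simp
    | add a b ha hb => simp only [map_add, add_mul, mul_add, ha, hb]
    | tmul a b =>
      induction y with
      | zero => simp
      | add a b ha hb => simp only [map_add, add_mul, mul_add, ha, hb]
      | tmul c d => simp [G, HopfAlgebra.antipode_mul_antidistrib]
  have h3 := h2 R R
  rw [← hR.id_comul, h1, hR.slice_counit, HopfAlgebra.antipode_one,
    ← Algebra.TensorProduct.one_def] at h3
  calc _ = R * ((HopfAlgebra.antipode k).rTensor H R *
        TensorProduct.map (HopfAlgebra.antipode k) (HopfAlgebra.antipode k) R) := by
        rw [← mul_assoc, hR.mul_rTensor_antipode, one_mul]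
    _ = R := by rw [← h3, mul_one]

end IsRMatrix

/-! ### Convolution algebras and the square of the antipode -/

section Convolution

variable {k C A : Type*} [Field k] [AddCommGroup C] [Module k C] [Coalgebra k C]
  [Ring A] [Algebra k A]

/-- The element `c ↦ ε(c) x` of the convolution algebra. -/
def convConst (x : A) : WithConv (C →ₗ[k] A) :=
  WithConv.toConv ((Coalgebra.counit (R := k) (A := C)).smulRight x)

/-- Constants turn a fixed element into a factor of a convolution product. An identity such as ∑
S(h₂) x h₁ = ε(h) x can then be solved by multiplying with convolution inverses instead of
rearranging Sweedler sums. -/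
theorem convConst_mul_apply (x : A) (f : WithConv (C →ₗ[k] A)) (c : C) :
    (convConst x * f : WithConv (C →ₗ[k] A)) c = x * f c := by
  rw [(Coalgebra.Repr.arbitrary k c).convMul_apply]
  conv_rhs => rw [← Coalgebra.sum_counit_smul (Coalgebra.Repr.arbitrary k c), map_sum,
    Finset.mul_sum]
  exact Finset.sum_congr rfl fun i _ => by simp [convConst]

theorem mul_convConst_apply (x : A) (f : WithConv (C →ₗ[k] A)) (c : C) :
    (f * convConst x : WithConv (C →ₗ[k] A)) c = f c * x := by
  rw [(Coalgebra.Repr.arbitrary k c).convMul_apply]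
  have h := congrArg (TensorProduct.rid k C)
    (Coalgebra.sum_tmul_counit_eq (Coalgebra.Repr.arbitrary k c))
  simp only [map_sum, TensorProduct.rid_tmul, one_smul] at h
  conv_rhs => rw [← h, map_sum, Finset.sum_mul]
  exact Finset.sum_congr rfl fun i _ => by simp [convConst]

end Convolution

namespace HopfAlgebra

variable (k H : Type*) [Field k] [Ring H] [HopfAlgebra k H]

/-- The antipode as an element of the convolution algebra of maps `H → Hᵒᵖ`. -/
def convAntipodeOp : WithConv (H →ₗ[k] Hᵐᵒᵖ) :=
  WithConv.toConv ((opLinearEquiv k).toLinearMap ∘ₗ antipode k)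

/-- The square of the antipode as an element of the convolution algebra of maps `H → Hᵒᵖ`. -/
def convAntipodeSqOp : WithConv (H →ₗ[k] Hᵐᵒᵖ) :=
  WithConv.toConv ((opLinearEquiv k).toLinearMap ∘ₗ antipode k ∘ₗ antipode k)

/-- The identity as an element of the convolution algebra of maps `H → Hᵒᵖ`. -/
def convIdOp : WithConv (H →ₗ[k] Hᵐᵒᵖ) :=
  WithConv.toConv (opLinearEquiv k).toLinearMap

/-- In Hᵒᵖ the product reads ∑ S²(x₂)S(x₁) = S(∑ x₁S(x₂)). With the companion lemma, S² is the
convolution inverse of S in Hom(H, Hᵒᵖ), whether or not S is bijective. -/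
theorem convAntipodeOp_mul_convAntipodeSqOp :
    convAntipodeOp k H * convAntipodeSqOp k H = 1 := by
  refine WithConv.ofConv_injective (LinearMap.ext fun x => ?_)
  change (convAntipodeOp k H * convAntipodeSqOp k H) x = (1 : WithConv (H →ₗ[k] Hᵐᵒᵖ)) x
  rw [(Coalgebra.Repr.arbitrary k x).convMul_apply]
  have h := congrArg (antipode k)
    (sum_mul_antipode_eq_algebraMap_counit (Coalgebra.Repr.arbitrary k x))
  rw [map_sum, Algebra.algebraMap_eq_smul_one, map_smul, antipode_one] at h
  refine unop_injective ?_
  simpa [convAntipodeOp, convAntipodeSqOp, antipode_mul_antidistrib,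
    Algebra.algebraMap_eq_smul_one] using h

theorem convAntipodeSqOp_mul_convAntipodeOp :
    convAntipodeSqOp k H * convAntipodeOp k H = 1 := by
  refine WithConv.ofConv_injective (LinearMap.ext fun x => ?_)
  change (convAntipodeSqOp k H * convAntipodeOp k H) x = (1 : WithConv (H →ₗ[k] Hᵐᵒᵖ)) x
  rw [(Coalgebra.Repr.arbitrary k x).convMul_apply]
  have h := congrArg (antipode k)
    (sum_antipode_mul_eq_algebraMap_counit (Coalgebra.Repr.arbitrary k x))
  rw [map_sum, Algebra.algebraMap_eq_smul_one, map_smul, antipode_one] at h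
  refine unop_injective ?_
  simpa [convAntipodeOp, convAntipodeSqOp, antipode_mul_antidistrib,
    Algebra.algebraMap_eq_smul_one] using h

end HopfAlgebra

/-! ### The Drinfeld element and its inverse -/

namespace IsRMatrix

variable {k H : Type*} [Field k] [Ring H] [HopfAlgebra k H] {R : H ⊗[k] H}

open HopfAlgebra

/-- `∑ S²(R¹) R²`, the inverse of `S(u)`. -/
def antipodeDrinfeldInv (R : H ⊗[k] H) : H :=
  LinearMap.mul' k H ((antipode k ∘ₗ antipode k).rTensor H R)

/-- `x ⊗ y ↦ S(x) y`. -/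
def antipodeMul : H ⊗[k] H →ₗ[k] H := LinearMap.mul' k H ∘ₗ (antipode k).rTensor H

/-- `x ⊗ y ↦ x S(y)`. -/
def mulAntipode : H ⊗[k] H →ₗ[k] H := LinearMap.mul' k H ∘ₗ (antipode k).lTensor H

theorem mulAntipode_tmul (x y : H) : mulAntipode (x ⊗ₜ[k] y) = x * antipode k y := rfl

theorem antipode_drinfeldElement (R : H ⊗[k] H) : antipode k (drinfeldElement R) =
    mulAntipode (TensorProduct.map (antipode k) (antipode k) R) := by
  rw [drinfeldElement]
  induction R with
  | zero => simp
  | add a b ha hb => simp only [map_add, ha, hb]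
  | tmul a b => simp [mulAntipode, antipode_mul_antidistrib]

theorem antipode_drinfeldElement_eq (hR : IsRMatrix R) : antipode k (drinfeldElement R) =
    mulAntipode R := by
  rw [antipode_drinfeldElement, hR.map_antipode_antipode]

theorem antipodeMul_rTensor_antipode (R : H ⊗[k] H) :
    antipodeMul ((antipode k).rTensor H R) = antipodeDrinfeldInv R := by
  rw [antipodeDrinfeldInv, LinearMap.rTensor_comp]; rfl

/-- Write d for `antipodeDrinfeldInv R`. Applying m(S ⊗ id) to Δ(x)R⁻¹ = R⁻¹Δᶜᵒᵖ(x), where R⁻¹ = (S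
⊗ id)(R), gives ε(x) d = ∑ S(x₂) d x₁. Convolving in Hᵒᵖ with S², the inverse of S, isolates d h. -/
theorem antipodeDrinfeldInv_mul (hR : IsRMatrix R) (h : H) :
    antipodeDrinfeldInv R * h = antipode k (antipode k h) * antipodeDrinfeldInv R := by
  -- Products in Hᵒᵖ are reversed, so this says ∑ S(x₂) d x₁ = ε(x) d.
  have key : convIdOp k H * convConst (op (antipodeDrinfeldInv R)) * convAntipodeOp k H =
      convConst (op (antipodeDrinfeldInv R)) := by
    refine WithConv.ofConv_injective (LinearMap.ext fun x => ?_)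
    change (convIdOp k H * convConst (op (antipodeDrinfeldInv R)) * convAntipodeOp k H :
      WithConv (H →ₗ[k] Hᵐᵒᵖ)) x =
      (convConst (op (antipodeDrinfeldInv R)) : WithConv (H →ₗ[k] Hᵐᵒᵖ)) x
    have h1 : Coalgebra.comul (R := k) x * (antipode k).rTensor H R =
        (antipode k).rTensor H R * TensorProduct.comm k H H (Coalgebra.comul (R := k) x) := by
      calc _ = (antipode k).rTensor H R * (R * Coalgebra.comul (R := k) x) *
            (antipode k).rTensor H R := by
            rw [← mul_assoc, hR.rTensor_antipode_mul, one_mul]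
        _ = _ := by
            rw [← hR.comul_op, mul_assoc, mul_assoc, hR.mul_rTensor_antipode, mul_one]
    have h2 := congrArg antipodeMul h1
    have h3 (y z : H ⊗[k] H) : antipodeMul (y * (antipode k).rTensor H z) =
        LinearMap.mul' k H (TensorProduct.map (antipode k ∘ₗ antipode k)
          (LinearMap.mulLeft k (antipodeMul y)) z) := by
      induction z with
      | zero => simp
      | add a b ha hb => simp only [map_add, mul_add, ha, hb]
      | tmul a b =>
        induction y with
        | zero => simp
        | add c d hc hd =>
          simp only [TensorProduct.map_tmul, LinearMap.mul'_apply,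
             LinearMap.mulLeft_apply] at hc hd ⊢
          simp only [map_add, add_mul, mul_add, hc, hd]
        | tmul c d => simp [antipodeMul, antipode_mul_antidistrib, mul_assoc]
    have h4 (y z : H ⊗[k] H) : antipodeMul (z * TensorProduct.comm k H H y) =
        LinearMap.mul' k H (TensorProduct.map (antipode k)
          (LinearMap.mulLeft k (antipodeMul z)) (TensorProduct.comm k H H y)) := by
      induction y with
      | zero => simp
      | add a b ha hb => simp only [map_add, mul_add, ha, hb]
      | tmul a b =>
        induction z with
        | zero => simp
        | add c d hc hd =>
          simp only [TensorProduct.map_tmul, LinearMap.mul'_apply,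
             LinearMap.mulLeft_apply, TensorProduct.comm_tmul] at hc hd ⊢
          simp only [map_add, add_mul, mul_add, hc, hd]
        | tmul c d => simp [antipodeMul, antipode_mul_antidistrib, mul_assoc]
    rw [h3, h4, antipodeMul_rTensor_antipode,
      show antipodeMul (Coalgebra.comul (R := k) x) = algebraMap k H (Coalgebra.counit x) from
        mul_antipode_rTensor_comul_apply x] at h2
    have h5 (z : H ⊗[k] H) (c : k) : LinearMap.mul' k H (TensorProduct.map
        (antipode k ∘ₗ antipode k) (LinearMap.mulLeft k (algebraMap k H c)) z) =
        c • antipodeDrinfeldInv z := by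
      rw [antipodeDrinfeldInv]
      induction z with
      | zero => simp
      | add a b ha hb => simp only [map_add, smul_add, ha, hb]
      | tmul a b => simp [Algebra.algebraMap_eq_smul_one]
    rw [h5, ← (Coalgebra.Repr.arbitrary k x).eq] at h2
    rw [(Coalgebra.Repr.arbitrary k x).convMul_apply]
    refine unop_injective ?_
    simp only [mul_convConst_apply]
    simpa [convIdOp, convAntipodeOp, convConst] using h2.symm
  have key2 : convIdOp k H * convConst (op (antipodeDrinfeldInv R)) =
      convConst (op (antipodeDrinfeldInv R)) * convAntipodeSqOp k H := by
    conv_rhs => rw [← key, mul_assoc, convAntipodeOp_mul_convAntipodeSqOp, mul_one]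
  have := congrArg (fun f : WithConv (H →ₗ[k] Hᵐᵒᵖ) => unop (f.ofConv h)) key2
  simp only [mul_convConst_apply, convConst_mul_apply] at this
  simpa [convIdOp, convAntipodeSqOp] using this

/-- The mirror argument: m(id ⊗ S) applied to Δᶜᵒᵖ(x)R = RΔ(x) gives ∑ x₂ S(u) S(x₁) = ε(x) S(u). It
is proved separately because `antipodeDrinfeldInv R` and S(u) are not yet known to be inverse to
each other. -/
theorem mul_mulAntipode (hR : IsRMatrix R) (h : H) :
    h * mulAntipode R = mulAntipode R * antipode k (antipode k h) := by
  have key : convAntipodeOp k H * convConst (op (mulAntipode R)) * convIdOp k H =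
      convConst (op (mulAntipode R)) := by
    refine WithConv.ofConv_injective (LinearMap.ext fun x => ?_)
    change (convAntipodeOp k H * convConst (op (mulAntipode R)) * convIdOp k H :
      WithConv (H →ₗ[k] Hᵐᵒᵖ)) x =
      (convConst (op (mulAntipode R)) : WithConv (H →ₗ[k] Hᵐᵒᵖ)) x
    have h2 := congrArg mulAntipode (hR.comul_op x)
    have h3 (y z : H ⊗[k] H) : mulAntipode (z * y) =
        LinearMap.mul' k H (TensorProduct.map (LinearMap.mulRight k (mulAntipode y))
          (antipode k) z) := by
      induction z with
      | zero => simp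
      | add a b ha hb => simp only [map_add, add_mul, ha, hb]
      | tmul a b =>
        induction y with
        | zero => simp
        | add c d hc hd =>
          simp only [TensorProduct.map_tmul, LinearMap.mul'_apply,
             LinearMap.mulRight_apply] at hc hd ⊢
          simp only [map_add, add_mul, mul_add, hc, hd]
        | tmul c d => simp [mulAntipode, antipode_mul_antidistrib, mul_assoc]
    have h5 (z : H ⊗[k] H) (c : k) : LinearMap.mul' k H (TensorProduct.map
        (LinearMap.mulRight k (algebraMap k H c)) (antipode k) z) = c • mulAntipode z := by
      induction z with
      | zero => simp
      | add a b ha hb => simp only [map_add, smul_add, ha, hb]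
      | tmul a b => simp [Algebra.algebraMap_eq_smul_one, mulAntipode]
    rw [h3, h3, show mulAntipode (Coalgebra.comul (R := k) x) =
      algebraMap k H (Coalgebra.counit x) from mul_antipode_lTensor_comul_apply x, h5,
      ← (Coalgebra.Repr.arbitrary k x).eq] at h2
    rw [(Coalgebra.Repr.arbitrary k x).convMul_apply]
    refine unop_injective ?_
    simp only [mul_convConst_apply]
    simpa [convIdOp, convAntipodeOp, convConst, mul_assoc] using h2
  have key2 : convConst (op (mulAntipode R)) * convIdOp k H =
      convAntipodeSqOp k H * convConst (op (mulAntipode R)) := by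
    conv_rhs => rw [← key]
    rw [mul_assoc, ← mul_assoc, convAntipodeSqOp_mul_convAntipodeOp, one_mul]
  have := congrArg (fun f : WithConv (H →ₗ[k] Hᵐᵒᵖ) => unop (f.ofConv h)) key2
  simp only [mul_convConst_apply, convConst_mul_apply] at this
  simpa [convIdOp, convAntipodeSqOp] using this

/-- Moving d past the first factor gives d R¹S(R²) = S²(R¹) d S(R²), which is m(S ⊗ id) of R⁻¹ · (S
⊗ S)(R) = R⁻¹R = 1. -/
theorem antipodeDrinfeldInv_mul_mulAntipode (hR : IsRMatrix R) :
    antipodeDrinfeldInv R * mulAntipode R = 1 := by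
  have h1 (y : H ⊗[k] H) (a b : H) :
      antipode k (antipode k a) * antipodeDrinfeldInv y * antipode k b =
        antipodeMul ((antipode k).rTensor H y * (antipode k a ⊗ₜ antipode k b)) := by
    rw [antipodeDrinfeldInv]
    induction y with
    | zero => simp
    | add c d hc hd => simp only [map_add, add_mul, mul_add, hc, hd]
    | tmul c d => simp [antipodeMul, antipode_mul_antidistrib, mul_assoc]
  have h2 (z : H ⊗[k] H) : antipodeDrinfeldInv R * mulAntipode z =
      antipodeMul ((antipode k).rTensor H R *
        TensorProduct.map (antipode k) (antipode k) z) := by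
    induction z with
    | zero => simp
    | add a b ha hb => simp only [map_add, mul_add, ha, hb]
    | tmul a b =>
      rw [mulAntipode_tmul, ← mul_assoc, hR.antipodeDrinfeldInv_mul, h1, TensorProduct.map_tmul]
  rw [h2, hR.map_antipode_antipode, hR.rTensor_antipode_mul, Algebra.TensorProduct.one_def]
  simp [antipodeMul]

/-- Here S(u)S²(R¹)R² = R¹S(u)R². Replacing R by (S ⊗ S)(R) turns this into m(id ⊗ S) of R⁻¹R = 1.
-/
theorem mulAntipode_mul_antipodeDrinfeldInv (hR : IsRMatrix R) :
    mulAntipode R * antipodeDrinfeldInv R = 1 := by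
  have h1 (z : H ⊗[k] H) : mulAntipode R * antipodeDrinfeldInv z =
      LinearMap.mul' k H ((LinearMap.mulRight k (mulAntipode R)).rTensor H z) := by
    rw [antipodeDrinfeldInv]
    induction z with
    | zero => simp
    | add a b ha hb => simp only [map_add, mul_add, ha, hb]
    | tmul a b => simp [← mul_assoc, hR.mul_mulAntipode]
  have h2 (y : H ⊗[k] H) (a b : H) : antipode k a * mulAntipode y * antipode k b =
      mulAntipode ((antipode k a ⊗ₜ b) * y) := by
    induction y with
    | zero => simp
    | add c d hc hd => simp only [map_add, mul_add, add_mul, hc, hd]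
    | tmul c d => simp [mulAntipode, antipode_mul_antidistrib, mul_assoc]
  have h3 (y z : H ⊗[k] H) : LinearMap.mul' k H ((LinearMap.mulRight k (mulAntipode y)).rTensor H
      (TensorProduct.map (antipode k) (antipode k) z)) =
      mulAntipode ((antipode k).rTensor H z * y) := by
    induction z with
    | zero => simp
    | add a b ha hb => simp only [map_add, add_mul, ha, hb]
    | tmul a b =>
      rw [LinearMap.rTensor_tmul, ← h2]
      rfl
  have h4 := h3 R R
  rw [hR.map_antipode_antipode, hR.rTensor_antipode_mul, Algebra.TensorProduct.one_def] at h4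
  rw [h1, h4]
  simp [mulAntipode]

/-- The inverse of `S(u)` as a unit. -/
def antipodeDrinfeldInvUnit (hR : IsRMatrix R) : Hˣ where
  val := antipodeDrinfeldInv R
  inv := mulAntipode R
  val_inv := hR.antipodeDrinfeldInv_mul_mulAntipode
  inv_val := hR.mulAntipode_mul_antipodeDrinfeldInv

/-- S² is conjugation by the unit d. -/
theorem antipode_antipode_bijective (hR : IsRMatrix R) :
    Function.Bijective (antipode k ∘ₗ antipode k : H →ₗ[k] H) := by
  have h (x : H) : (antipode k ∘ₗ antipode k) x =
      antipodeDrinfeldInv R * x * mulAntipode R := by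
    rw [hR.antipodeDrinfeldInv_mul, mul_assoc, hR.antipodeDrinfeldInv_mul_mulAntipode, mul_one]
    rfl
  constructor
  · intro x y hxy
    rw [h, h] at hxy
    simpa using (hR.antipodeDrinfeldInvUnit⁻¹).isUnit.mul_right_cancel hxy |>
      hR.antipodeDrinfeldInvUnit.isUnit.mul_left_cancel
  · intro x
    refine ⟨mulAntipode R * x * antipodeDrinfeldInv R, ?_⟩
    rw [h, ← mul_assoc, ← mul_assoc, hR.antipodeDrinfeldInv_mul_mulAntipode, one_mul, mul_assoc,
      hR.antipodeDrinfeldInv_mul_mulAntipode, mul_one]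

end IsRMatrix

/-! ### Presentations of R over L, and covariant pairs -/

/-- The orbit map `h ↦ h v` of a vector `v`. -/
def orbitMap (k : Type*) {H V : Type*} [Field k] [Ring H] [Algebra k H] [AddCommGroup V]
    [Module k V] [Module H V] [IsScalarTower k H V] (v : V) : H →ₗ[k] V :=
  (Algebra.lsmul k k V).toLinearMap.flip v

@[simp]
theorem orbitMap_apply {k H V : Type*} [Field k] [Ring H] [Algebra k H] [AddCommGroup V]
    [Module k V] [Module H V] [IsScalarTower k H V] (v : V) (h : H) :
    orbitMap k v h = h • v := rfl

/-- The coassociativity law `∑ F(l₁₁, l₁₂, l₂) = ∑ F(l₁, l₂₁, l₂₂)`. -/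
theorem Coalgebra.sum_coassoc {k C M : Type*} [Field k] [AddCommGroup C] [Module k C] [Coalgebra k C]
    [AddCommGroup M] [Module k M] (F : C →ₗ[k] C →ₗ[k] C →ₗ[k] M) (c : C) :
    ∑ r ∈ (ℛ k c).index,
      ∑ q ∈ (ℛ k ((ℛ k c).left r)).index,
        F ((ℛ k ((ℛ k c).left r)).left q)
          ((ℛ k ((ℛ k c).left r)).right q)
          ((ℛ k c).right r) =
    ∑ r ∈ (ℛ k c).index,
      ∑ q ∈ (ℛ k ((ℛ k c).right r)).index,
        F ((ℛ k c).left r)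
          ((ℛ k ((ℛ k c).right r)).left q)
          ((ℛ k ((ℛ k c).right r)).right q) := by
  let G : C ⊗[k] (C ⊗[k] C) →ₗ[k] M :=
    TensorProduct.lift ((TensorProduct.uncurry (RingHom.id k) C C M :
      (C →ₗ[k] C →ₗ[k] M) →ₗ[k] _) ∘ₗ F)
  have h := congrArg G (Coalgebra.sum_tmul_tmul_eq (ℛ k c)
    (fun i => ℛ k ((ℛ k c).left i))
    (fun i => ℛ k ((ℛ k c).right i)))
  simpa [G] using h

/-- A presentation `R = ∑ f(a i) ⊗ b i` of a tensor `R ∈ H ⊗ H`, where `f : L → H` is an injective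
homomorphism of Hopf algebras. -/
structure LeftPresentation {k L H ι : Type*} [Field k] [Ring L] [HopfAlgebra k L]
    [Ring H] [HopfAlgebra k H] (R : H ⊗[k] H) (f : L →ₐ[k] H) (s : Finset ι) (a : ι → L)
    (b : ι → H) : Prop where
  injective : Function.Injective f
  map_comul : ∀ l : L, TensorProduct.map f.toLinearMap f.toLinearMap
    (Coalgebra.comul (R := k) l) = Coalgebra.comul (R := k) (f l)
  map_antipode : ∀ l : L, f (HopfAlgebra.antipode k l) = HopfAlgebra.antipode k (f l)
  sum_eq : ∑ i ∈ s, f (a i) ⊗ₜ[k] b i = R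

namespace LeftPresentation

variable {k L H ι : Type*} [Field k] [Ring L] [HopfAlgebra k L]
  [Ring H] [HopfAlgebra k H] {R : H ⊗[k] H} {f : L →ₐ[k] H} {s : Finset ι} {a : ι → L}
  {b : ι → H}

/-- This lemma and the next three transport identities of R to tensors with a leg in L. Over a
field, tensoring the injective f with identities stays injective, so it suffices to compare images
in tensor powers of H. -/
theorem comul_left (P : LeftPresentation R f s a b) (hR : IsRMatrix R) :
    ∑ i ∈ s, Coalgebra.comul (R := k) (a i) ⊗ₜ[k] b i =
      ∑ i ∈ s, ∑ j ∈ s, (a i ⊗ₜ[k] a j) ⊗ₜ[k] (b i * b j) := by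
  have hinj : Function.Injective ((TensorProduct.map f.toLinearMap f.toLinearMap).rTensor H) :=
    Module.Flat.rTensor_preserves_injective_linearMap _
      (TensorProduct.map_injective_of_flat_flat _ _ P.injective P.injective)
  apply hinj
  apply (TensorProduct.assoc k H H H).injective
  have h := hR.comul_id
  rw [← P.sum_eq] at h
  simp only [map_sum, LinearMap.rTensor_tmul, P.map_comul, Finset.sum_mul_sum, leg13_tmul,
    leg23_tmul] at h ⊢
  rw [h]
  simp

theorem comul_right (P : LeftPresentation R f s a b) (hR : IsRMatrix R) :
    ∑ i ∈ s, a i ⊗ₜ[k] Coalgebra.comul (R := k) (b i) =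
      ∑ i ∈ s, ∑ j ∈ s, (a i * a j) ⊗ₜ[k] (b j ⊗ₜ[k] b i) := by
  apply Module.Flat.rTensor_preserves_injective_linearMap (M := H ⊗[k] H) f.toLinearMap P.injective
  have h := hR.id_comul
  rw [← P.sum_eq] at h
  simp only [map_sum, LinearMap.rTensor_tmul, LinearMap.lTensor_tmul, Finset.sum_mul_sum,
    leg13_tmul, leg12_tmul] at h ⊢
  refine h.trans ?_
  simp

theorem comul_op (P : LeftPresentation R f s a b) (hR : IsRMatrix R) (l : L) :
    ∑ i ∈ s, ∑ r ∈ (ℛ k l).index,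
      ((ℛ k l).right r * a i) ⊗ₜ[k]
        (f ((ℛ k l).left r) * b i) =
    ∑ i ∈ s, ∑ r ∈ (ℛ k l).index,
      (a i * (ℛ k l).left r) ⊗ₜ[k]
        (b i * f ((ℛ k l).right r)) := by
  apply Module.Flat.rTensor_preserves_injective_linearMap (M := H) f.toLinearMap P.injective
  have h := hR.comul_op (f l)
  rw [← P.sum_eq, ← P.map_comul, ← (ℛ k l).eq] at h
  simp only [map_sum, TensorProduct.map_tmul, TensorProduct.comm_tmul, Finset.sum_mul_sum,
    Algebra.TensorProduct.tmul_mul_tmul, LinearMap.rTensor_tmul, AlgHom.toLinearMap_apply,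
    map_mul] at h ⊢
  rw [Finset.sum_comm]
  exact h

theorem sum_mul_antipode (P : LeftPresentation R f s a b) (hR : IsRMatrix R) :
    ∑ i ∈ s, ∑ j ∈ s, (a i * HopfAlgebra.antipode k (a j)) ⊗ₜ[k] (b i * b j) = 1 := by
  apply Module.Flat.rTensor_preserves_injective_linearMap (M := H) f.toLinearMap P.injective
  have h := hR.mul_rTensor_antipode
  rw [← P.sum_eq] at h
  simp only [map_sum, Finset.sum_mul_sum, Algebra.TensorProduct.tmul_mul_tmul,
    LinearMap.rTensor_tmul, AlgHom.toLinearMap_apply, map_mul, P.map_antipode] at h ⊢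
  rw [h, Algebra.TensorProduct.one_def, Algebra.TensorProduct.one_def, LinearMap.rTensor_tmul,
    AlgHom.toLinearMap_apply, map_one]

/-- This is S(u) d = 1 with S(u) written as ∑ S(R¹)S²(R²), after S²(R²) d is replaced by d R². It is
the cancellation behind τβ = α. -/
theorem sum_antipode_mul_antipodeDrinfeldInv_mul (P : LeftPresentation R f s a b)
    (hR : IsRMatrix R) :
    ∑ i ∈ s, f (HopfAlgebra.antipode k (a i)) * (IsRMatrix.antipodeDrinfeldInv R * b i) = 1 := by
  have h := hR.mulAntipode_mul_antipodeDrinfeldInv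
  conv at h => enter [1, 1]; rw [← hR.map_antipode_antipode]
  nth_rw 1 [← P.sum_eq] at h
  rw [← h, map_sum, map_sum, Finset.sum_mul]
  refine Finset.sum_congr rfl fun i _ => ?_
  rw [hR.antipodeDrinfeldInv_mul, P.map_antipode, TensorProduct.map_tmul,
    IsRMatrix.mulAntipode_tmul, mul_assoc]

end LeftPresentation

/-- A quantum commutative algebra: `v w = ∑ (b i w) (f (a i) v)`. -/
theorem IsQuantumCommutative.mul_eq_sum {k L H V ι : Type*} [Field k] [Ring L] [HopfAlgebra k L]
    [Ring H] [HopfAlgebra k H] {R : H ⊗[k] H} {f : L →ₐ[k] H} {s : Finset ι} {a : ι → L}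
    {b : ι → H} [Ring V] [Algebra k V] [Module H V] [IsScalarTower k H V]
    (hV : IsQuantumCommutative (V := V) R) (P : LeftPresentation R f s a b) (v w : V) :
    ∑ i ∈ s, (b i • w) * (f (a i) • v) = v * w := by
  rw [hV v w, ← P.sum_eq]
  simp [LinearMap.sum_apply]

/-- A covariant pair: algebra homomorphisms `α : V → T` and `j : L → T` such that
`j(l) α(v) = ∑ α(l₁ v) j(l₂)`. -/
def IsCovariantPair {k L V T : Type*} [Field k] [Ring L] [Bialgebra k L] [Ring V] [Algebra k V]
    [Module L V] [IsScalarTower k L V] [Ring T] [Algebra k T] (α : V →ₐ[k] T) (j : L →ₐ[k] T) :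
    Prop :=
  ∀ (l : L) (v : V), j l * α v = LinearMap.mul' k T (TensorProduct.map
    (α.toLinearMap ∘ₗ orbitMap k v) j.toLinearMap (Coalgebra.comul (R := k) l))

theorem IsCovariantPair.mul_eq_sum {k L V T κ : Type*} [Field k] [Ring L] [Bialgebra k L]
    [Ring V] [Algebra k V] [Module L V] [IsScalarTower k L V] [Ring T] [Algebra k T]
    {α : V →ₐ[k] T} {j : L →ₐ[k] T} (h : IsCovariantPair α j) (l : L) (v : V)
    (r : Coalgebra.Repr k l κ) :
    j l * α v = ∑ i ∈ r.index, α (r.left i • v) * j (r.right i) := by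
  rw [h, ← r.eq]
  simp

/-! ### The target map: multiplicativity and exchange rules -/

section Target

variable {k L H V T ι : Type*} [Field k] [Ring L] [HopfAlgebra k L]
  [Ring H] [HopfAlgebra k H] {R : H ⊗[k] H} {f : L →ₐ[k] H} {s : Finset ι} {a : ι → L}
  {b : ι → H} [Ring V] [Algebra k V] [Module H V] [IsScalarTower k H V]
  [Ring T] [Algebra k T] {α : V →ₐ[k] T} {j : L →ₐ[k] T}

/-- The target map `β(v) = ∑ α(b i v) j(a i)`. -/
def targetMap (s : Finset ι) (a : ι → L) (b : ι → H) (α : V →ₐ[k] T) (j : L →ₐ[k] T) :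
    V →ₗ[k] T where
  toFun v := ∑ i ∈ s, α (b i • v) * j (a i)
  map_add' v w := by simp [add_mul, Finset.sum_add_distrib]
  map_smul' c v := by
    simp only [RingHom.id_apply, Finset.smul_sum]
    exact Finset.sum_congr rfl fun i _ => by
      rw [← smul_one_smul H c v, ← mul_smul, mul_smul_comm, mul_one, smul_assoc, map_smul,
        smul_mul_assoc]

theorem targetMap_apply (v : V) :
    targetMap s a b α j v = ∑ i ∈ s, α (b i • v) * j (a i) := rfl

/-- H acts on 1 through ε, so the sum collapses to j applied to (id ⊗ ε)(R) = 1. -/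
theorem targetMap_one [ModuleAlgebra k H V] (P : LeftPresentation R f s a b) (hR : IsRMatrix R) :
    targetMap s a b α j 1 = 1 := by
  have h := hR.slice_counit
  rw [← P.sum_eq] at h
  simp only [map_sum, slice_tmul, ← map_smul] at h
  rw [← map_sum, ← map_one f] at h
  rw [targetMap_apply, ← map_one j, ← P.injective h, map_sum]
  refine Finset.sum_congr rfl fun i _ => ?_
  rw [ModuleAlgebra.smul_one (k := k)]
  simp

variable [Module L V] [IsScalarTower k L V]

/-- Covariance moves α(v) to the left and splits R¹; (Δ ⊗ id)(R) = R₁₃R₂₃ then provides two copies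
of R. Quantum commutativity absorbs one of them, and the other forms β(w). -/
theorem targetMap_mul_source (P : LeftPresentation R f s a b) (hR : IsRMatrix R)
    (hV : IsQuantumCommutative (V := V) R) (hf : ∀ (l : L) (v : V), l • v = f l • v)
    (hαj : IsCovariantPair α j) (v w : V) :
    targetMap s a b α j w * α v = α v * targetMap s a b α j w := by
  let Φ : (L ⊗[k] L) ⊗[k] H →ₗ[k] T := LinearMap.mul' k T ∘ₗ
    TensorProduct.map (α.toLinearMap ∘ₗ orbitMap k w) (LinearMap.mul' k T ∘ₗ TensorProduct.map
    (α.toLinearMap ∘ₗ orbitMap k v) j.toLinearMap) ∘ₗ (TensorProduct.comm k (L ⊗[k] L) H).toLinearMap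
  have h := congrArg Φ (P.comul_left hR)
  simp only [map_sum] at h
  have h1 : targetMap s a b α j w * α v =
      ∑ i ∈ s, Φ (Coalgebra.comul (R := k) (a i) ⊗ₜ[k] b i) := by
    rw [targetMap_apply, Finset.sum_mul]
    refine Finset.sum_congr rfl fun i _ => ?_
    rw [mul_assoc, hαj]
    rfl
  rw [h1, h, Finset.sum_comm, targetMap_apply, Finset.mul_sum]
  refine Finset.sum_congr rfl fun i _ => ?_
  rw [← mul_assoc, ← map_mul, ← hV.mul_eq_sum P v, map_sum, Finset.sum_mul]
  refine Finset.sum_congr rfl fun n _ => ?_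
  simp [Φ, mul_assoc, mul_smul, hf]

/-- (id ⊗ Δ)(R) = R₁₃R₁₂ nests one copy of β inside the other: ∑ α(R² w) β(v) j(R¹). The inner β(v)
leaves to the left because it commutes with the image of α. -/
theorem targetMap_mul [ModuleAlgebra k H V] (P : LeftPresentation R f s a b) (hR : IsRMatrix R)
    (hV : IsQuantumCommutative (V := V) R) (hf : ∀ (l : L) (v : V), l • v = f l • v)
    (hαj : IsCovariantPair α j) (v w : V) :
    targetMap s a b α j (w * v) = targetMap s a b α j v * targetMap s a b α j w := by
  let Φ : L ⊗[k] (H ⊗[k] H) →ₗ[k] T := LinearMap.mul' k T ∘ₗ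
    TensorProduct.map (α.toLinearMap ∘ₗ LinearMap.mul' k V ∘ₗ
      TensorProduct.map (orbitMap k w) (orbitMap k v)) j.toLinearMap ∘ₗ
      (TensorProduct.comm k L (H ⊗[k] H)).toLinearMap
  have hΦ (l : L) (h : H) : Φ (l ⊗ₜ Coalgebra.comul (R := k) h) = α (h • (w * v)) * j l := by
    rw [ModuleAlgebra.smul_mul (k := k)]
    simp only [Φ, LinearMap.comp_apply, LinearEquiv.coe_coe, TensorProduct.comm_tmul,
      TensorProduct.map_tmul, LinearMap.mul'_apply, AlgHom.toLinearMap_apply]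
    congr 3
    induction Coalgebra.comul (R := k) h with
    | zero => simp
    | add x y hx hy => simp only [map_add, LinearMap.add_apply, hx, hy]
    | tmul x y => simp
  have h := congrArg Φ (P.comul_right hR)
  simp only [map_sum, hΦ] at h
  rw [targetMap_apply, h, targetMap_apply (v := w), Finset.mul_sum, Finset.sum_comm]
  refine Finset.sum_congr rfl fun n _ => ?_
  rw [← mul_assoc, targetMap_mul_source P hR hV hf hαj, targetMap_apply, Finset.mul_sum,
    Finset.sum_mul]
  refine Finset.sum_congr rfl fun i _ => ?_
  simp [Φ, mul_assoc]

/-- Covariance gives ∑ α(l₁R² v) j(l₂R¹), and Δᶜᵒᵖ R = R Δ moves l to the other side of R. Compared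
with the rule for α, the two legs of Δ(l) are exchanged. -/
theorem mul_targetMap (P : LeftPresentation R f s a b) (hR : IsRMatrix R)
    (hf : ∀ (l : L) (v : V), l • v = f l • v)
    (hαj : IsCovariantPair α j) (l : L) (v : V) :
    j l * targetMap s a b α j v = ∑ r ∈ (ℛ k l).index,
      targetMap s a b α j ((ℛ k l).right r • v) *
        j ((ℛ k l).left r) := by
  let Φ : L ⊗[k] H →ₗ[k] T := LinearMap.mul' k T ∘ₗ
    TensorProduct.map (α.toLinearMap ∘ₗ orbitMap k v) j.toLinearMap ∘ₗ
      (TensorProduct.comm k L H).toLinearMap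
  have hΦ (x : L) (h : H) : Φ (x ⊗ₜ h) = α (h • v) * j x := rfl
  have h := congrArg Φ (P.comul_op hR l)
  simp only [map_sum, hΦ] at h
  rw [targetMap_apply, Finset.mul_sum]
  simp only [targetMap_apply, Finset.sum_mul]
  rw [Finset.sum_comm]
  refine Eq.trans (Finset.sum_congr rfl fun i _ => ?_)
    (h.trans (Finset.sum_congr rfl fun i _ => ?_))
  · rw [← mul_assoc, hαj.mul_eq_sum l _ (ℛ k l), Finset.sum_mul]
    exact Finset.sum_congr rfl fun r _ => by rw [map_mul, mul_assoc, hf, mul_smul]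
  · exact Finset.sum_congr rfl fun r _ => by rw [map_mul, mul_assoc, hf, mul_smul]

end Target

/-! ### The target map and the antipode of L -/

section TargetAntipode

open HopfAlgebra

variable {k L H V T ι : Type*} [Field k] [Ring L] [HopfAlgebra k L]
  [Ring H] [HopfAlgebra k H] {R : H ⊗[k] H} {f : L →ₐ[k] H} {s : Finset ι} {a : ι → L}
  {b : ι → H} [Ring V] [Algebra k V] [Module H V] [IsScalarTower k H V]
  [Ring T] [Algebra k T] {α : V →ₐ[k] T} {j : L →ₐ[k] T} [Module L V] [IsScalarTower k L V]

/-- After `mul_targetMap` and coassociativity the vector is acted on by ∑ l₂S(l₃), which cancels. -/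
theorem sum_mul_targetMap_antipode (P : LeftPresentation R f s a b) (hR : IsRMatrix R)
    (hf : ∀ (l : L) (v : V), l • v = f l • v) (hαj : IsCovariantPair α j) (l : L) (v : V) :
    ∑ r ∈ (ℛ k l).index, j ((ℛ k l).left r) *
      targetMap s a b α j (antipode k ((ℛ k l).right r) • v) = targetMap s a b α j v * j l := by
  let N : L →ₗ[k] L →ₗ[k] T := ((LinearMap.mul k L).compl₂ (antipode k)).compr₂
    (targetMap s a b α j ∘ₗ orbitMap k v)
  let F : L →ₗ[k] L →ₗ[k] L →ₗ[k] T :=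
    { toFun := fun x => N.compr₂ (LinearMap.mulRight k (j x))
      map_add' := fun x y => by ext; simp [mul_add]
      map_smul' := fun c x => by ext; simp }
  have hF (x y z : L) : F x y z = targetMap s a b α j (y • antipode k z • v) * j x := by
    simp [F, N, mul_smul]
  have h := Coalgebra.sum_coassoc F l
  have h1 (r : L × L) : ∑ q ∈ (ℛ k ((ℛ k l).right r)).index,
      F ((ℛ k l).left r) ((ℛ k ((ℛ k l).right r)).left q) ((ℛ k ((ℛ k l).right r)).right q) =
      targetMap s a b α j v * j (Coalgebra.counit (R := k) ((ℛ k l).right r) • (ℛ k l).left r) := by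
    simp only [hF, ← mul_smul]
    rw [← Finset.sum_mul, ← map_sum, ← Finset.sum_smul, sum_mul_antipode_eq_smul, smul_assoc,
      one_smul, map_smul, map_smul, smul_mul_assoc, mul_smul_comm]
  rw [Finset.sum_congr rfl fun r _ => h1 r, ← Finset.mul_sum, ← map_sum] at h
  have h2 := congrArg (TensorProduct.rid k L) (Coalgebra.sum_tmul_counit_eq (ℛ k l))
  simp only [map_sum, TensorProduct.rid_tmul, one_smul] at h2
  rw [h2] at h
  rw [← h]
  refine Finset.sum_congr rfl fun r _ => ?_
  rw [mul_targetMap P hR hf hαj]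
  simp only [hF]

/-- With the next lemma: j ∘ S is the two-sided convolution inverse of j, which allows j to be moved
across convolution identities. -/
theorem convMap_antipode_mul (j : L →ₐ[k] T) :
    (WithConv.toConv (j.toLinearMap ∘ₗ antipode k) * WithConv.toConv j.toLinearMap :
      WithConv (L →ₗ[k] T)) = 1 := by
  refine WithConv.ofConv_injective (LinearMap.ext fun x => ?_)
  change (WithConv.toConv (j.toLinearMap ∘ₗ antipode k) * WithConv.toConv j.toLinearMap :
    WithConv (L →ₗ[k] T)) x = (1 : WithConv (L →ₗ[k] T)) x
  rw [(ℛ k x).convMul_apply]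
  have h := congrArg j (sum_antipode_mul_eq_algebraMap_counit (ℛ k x))
  simpa using h

theorem convMap_mul_antipode (j : L →ₐ[k] T) :
    (WithConv.toConv j.toLinearMap * WithConv.toConv (j.toLinearMap ∘ₗ antipode k) :
      WithConv (L →ₗ[k] T)) = 1 := by
  refine WithConv.ofConv_injective (LinearMap.ext fun x => ?_)
  change (WithConv.toConv j.toLinearMap * WithConv.toConv (j.toLinearMap ∘ₗ antipode k) :
    WithConv (L →ₗ[k] T)) x = (1 : WithConv (L →ₗ[k] T)) x
  rw [(ℛ k x).convMul_apply]
  have h := congrArg j (sum_mul_antipode_eq_algebraMap_counit (ℛ k x))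
  simpa using h

/-- The convolution form of `sum_mul_targetMap_antipode`, solved for `l ↦ β(S(l) v)`. -/
theorem convMap_targetMap_antipode (P : LeftPresentation R f s a b) (hR : IsRMatrix R)
    (hf : ∀ (l : L) (v : V), l • v = f l • v) (hαj : IsCovariantPair α j) (v : V) :
    WithConv.toConv (targetMap s a b α j ∘ₗ orbitMap k v ∘ₗ antipode k) =
      (WithConv.toConv (j.toLinearMap ∘ₗ antipode k) * convConst (targetMap s a b α j v) *
        WithConv.toConv j.toLinearMap : WithConv (L →ₗ[k] T)) := by
  have h : (WithConv.toConv j.toLinearMap *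
      WithConv.toConv (targetMap s a b α j ∘ₗ orbitMap k v ∘ₗ antipode k) :
      WithConv (L →ₗ[k] T)) =
      convConst (targetMap s a b α j v) * WithConv.toConv j.toLinearMap := by
    refine WithConv.ofConv_injective (LinearMap.ext fun x => ?_)
    change (WithConv.toConv j.toLinearMap *
      WithConv.toConv (targetMap s a b α j ∘ₗ orbitMap k v ∘ₗ antipode k) :
      WithConv (L →ₗ[k] T)) x =
      (convConst (targetMap s a b α j v) * WithConv.toConv j.toLinearMap :
      WithConv (L →ₗ[k] T)) x
    rw [(ℛ k x).convMul_apply, convConst_mul_apply]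
    exact sum_mul_targetMap_antipode P hR hf hαj x v
  rw [mul_assoc, ← h, ← mul_assoc, convMap_antipode_mul, one_mul]

/-- With d v in place of v, the left side is m(τ ⊗ id)Δ(v # l) and the right side is βετ(v # l). -/
theorem sum_antipode_mul_targetMap_mul (P : LeftPresentation R f s a b) (hR : IsRMatrix R)
    (hf : ∀ (l : L) (v : V), l • v = f l • v) (hαj : IsCovariantPair α j) (l : L) (v : V) :
    ∑ r ∈ (ℛ k l).index, j (antipode k ((ℛ k l).left r)) * targetMap s a b α j v *
      j ((ℛ k l).right r) = targetMap s a b α j (antipode k l • v) := by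
  have h := congrArg (fun g : WithConv (L →ₗ[k] T) => g.ofConv l)
    (convMap_targetMap_antipode P hR hf hαj v)
  have h' := h.trans ((ℛ k l).convMul_apply _ _)
  simp only [mul_convConst_apply] at h'
  exact h'.symm

/-- Convolving the formula for l ↦ β(S(l)v) on the right with j ∘ S cancels j. The coproduct of S(l)
is never needed. -/
theorem antipode_mul_targetMap (P : LeftPresentation R f s a b) (hR : IsRMatrix R)
    (hf : ∀ (l : L) (v : V), l • v = f l • v) (hαj : IsCovariantPair α j) (l : L) (v : V) :
    j (antipode k l) * targetMap s a b α j v = ∑ r ∈ (ℛ k l).index,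
      targetMap s a b α j (antipode k ((ℛ k l).left r) • v) *
        j (antipode k ((ℛ k l).right r)) := by
  have h : (WithConv.toConv (targetMap s a b α j ∘ₗ orbitMap k v ∘ₗ antipode k) *
      WithConv.toConv (j.toLinearMap ∘ₗ antipode k) : WithConv (L →ₗ[k] T)) =
      WithConv.toConv (j.toLinearMap ∘ₗ antipode k) * convConst (targetMap s a b α j v) := by
    rw [convMap_targetMap_antipode P hR hf hαj, mul_assoc, convMap_mul_antipode, mul_one]
  have h' := congrArg (fun g : WithConv (L →ₗ[k] T) => g.ofConv l) h
  exact (mul_convConst_apply _ _ l).symm.trans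
    (h'.symm.trans ((ℛ k l).convMul_apply _ _))

/-- The elements S(l₂)S²(l₁) = S(S(l₁)l₂) produced by `antipode_mul_targetMap` cancel. With d l =
S²(l) d this becomes the covariance of the pair that defines τ. -/
theorem sum_antipode_mul_targetMap_antipode (P : LeftPresentation R f s a b) (hR : IsRMatrix R)
    (hf : ∀ (l : L) (v : V), l • v = f l • v) (hαj : IsCovariantPair α j) (l : L) (v : V) :
    ∑ r ∈ (ℛ k l).index, j (antipode k ((ℛ k l).right r)) *
      targetMap s a b α j (antipode k (antipode k ((ℛ k l).left r)) • v) =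
      targetMap s a b α j v * j (antipode k l) := by
  let N : L →ₗ[k] L →ₗ[k] T := (LinearMap.mul k L).compr₂
    (targetMap s a b α j ∘ₗ orbitMap k v ∘ₗ antipode k) ∘ₗ antipode k
  let F : L →ₗ[k] L →ₗ[k] L →ₗ[k] T :=
    { toFun := fun x => (LinearMap.mul k T).compl₁₂ (N x) (j.toLinearMap ∘ₗ antipode k)
      map_add' := fun x y => by ext; simp
      map_smul' := fun c x => by ext; simp }
  have hF (x y z : L) : F x y z =
      targetMap s a b α j (antipode k (antipode k x * y) • v) * j (antipode k z) := by
    simp [F, N]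
  have h := Coalgebra.sum_coassoc F l
  have h1 (r : L × L) : ∑ q ∈ (ℛ k ((ℛ k l).left r)).index,
      F ((ℛ k ((ℛ k l).left r)).left q) ((ℛ k ((ℛ k l).left r)).right q) ((ℛ k l).right r) =
      targetMap s a b α j v *
        j (antipode k (Coalgebra.counit (R := k) ((ℛ k l).left r) • (ℛ k l).right r)) := by
    simp only [hF]
    rw [← Finset.sum_mul, ← map_sum, ← Finset.sum_smul, ← map_sum, sum_antipode_mul_eq_smul,
      LinearMap.map_smul, antipode_one, smul_assoc, one_smul]
    simp only [map_smul, smul_mul_assoc, mul_smul_comm]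
  rw [Finset.sum_congr rfl fun r _ => h1 r, ← Finset.mul_sum, ← map_sum, ← map_sum,
    Coalgebra.sum_counit_smul] at h
  rw [h]
  refine Finset.sum_congr rfl fun r _ => ?_
  rw [antipode_mul_targetMap P hR hf hαj]
  simp only [hF, antipode_mul_antidistrib, mul_smul]

/-- This is τβ = α, and the reason for the factor d₀ in τ. Moving j(S(R¹)) across β and splitting by
(Δ ⊗ id)(R) leaves ∑ S(R¹) d R² = 1 inside β; the remaining ∑ β(R² v) j(S(R¹)) is α(v) because R ·
(S ⊗ id)(R) = 1. -/
theorem sum_antipode_mul_targetMap (P : LeftPresentation R f s a b) (hR : IsRMatrix R)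
    (hf : ∀ (l : L) (v : V), l • v = f l • v) (hαj : IsCovariantPair α j) (v : V) :
    ∑ i ∈ s, j (antipode k (a i)) *
      targetMap s a b α j (IsRMatrix.antipodeDrinfeldInv R • b i • v) = α v := by
  let Φ : (L ⊗[k] L) ⊗[k] H →ₗ[k] T := TensorProduct.lift
    (TensorProduct.lift
      { toFun := fun x =>
          { toFun := fun y => LinearMap.mulRight k (j (antipode k y)) ∘ₗ targetMap s a b α j ∘ₗ
              orbitMap k v ∘ₗ
              LinearMap.mulLeft k (f (antipode k x) * IsRMatrix.antipodeDrinfeldInv R)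
            map_add' := fun y z => by ext; simp [mul_add]
            map_smul' := fun c y => by ext; simp }
        map_add' := fun x y => by ext; simp [add_mul, add_smul, mul_assoc]
        map_smul' := fun c x => by ext; simp [mul_assoc] })
  have hΦ (x y : L) (h : H) : Φ ((x ⊗ₜ y) ⊗ₜ h) = targetMap s a b α j
      (f (antipode k x) • IsRMatrix.antipodeDrinfeldInv R • h • v) * j (antipode k y) := by
    simp [Φ, mul_smul]
  have h := congrArg Φ (P.comul_left hR)
  simp only [map_sum] at h
  have h1 (i : ι) : j (antipode k (a i)) *
      targetMap s a b α j (IsRMatrix.antipodeDrinfeldInv R • b i • v) =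
      Φ (Coalgebra.comul (R := k) (a i) ⊗ₜ[k] b i) := by
    rw [antipode_mul_targetMap P hR hf hαj, ← (ℛ k (a i)).eq, TensorProduct.sum_tmul, map_sum]
    simp only [hΦ, hf]
  have h2 (n : ι) : ∑ i ∈ s, Φ ((a i ⊗ₜ[k] a n) ⊗ₜ[k] (b i * b n)) =
      targetMap s a b α j (b n • v) * j (antipode k (a n)) := by
    have h3 := P.sum_antipode_mul_antipodeDrinfeldInv_mul hR
    simp only [hΦ]
    rw [← Finset.sum_mul, ← map_sum]
    congr 2
    rw [← one_smul H (b n • v), ← h3, Finset.sum_smul]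
    simp only [mul_smul]
  rw [Finset.sum_congr rfl fun i _ => h1 i, h, Finset.sum_comm,
    Finset.sum_congr rfl fun n _ => h2 n]
  let Ψ : L ⊗[k] H →ₗ[k] T := LinearMap.mul' k T ∘ₗ
    TensorProduct.map (α.toLinearMap ∘ₗ orbitMap k v) j.toLinearMap ∘ₗ
      (TensorProduct.comm k L H).toLinearMap
  have h4 := congrArg Ψ (P.sum_mul_antipode hR)
  rw [Algebra.TensorProduct.one_def] at h4
  simp only [map_sum] at h4
  rw [Finset.sum_comm] at h4
  refine Eq.trans ?_ (h4.trans ?_)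
  · refine Finset.sum_congr rfl fun n _ => ?_
    rw [targetMap_apply, Finset.sum_mul]
    exact Finset.sum_congr rfl fun i _ => by simp [Ψ, mul_smul, mul_assoc]
  · simp [Ψ]

/-- Expanding α(R² v) by the preceding lemma creates a second copy of R, and the two copies cancel
through R · (S ⊗ id)(R) = 1. The result describes β(d v) without d, by a formula in which Δ can be
applied to R². -/
theorem sum_antipode_antipode_mul_source (P : LeftPresentation R f s a b) (hR : IsRMatrix R)
    (hf : ∀ (l : L) (v : V), l • v = f l • v) (hαj : IsCovariantPair α j) (v : V) :
    ∑ i ∈ s, j (antipode k (antipode k (a i))) * α (b i • v) =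
      targetMap s a b α j (IsRMatrix.antipodeDrinfeldInv R • v) := by
  let Ψ : L ⊗[k] H →ₗ[k] T := LinearMap.mul' k T ∘ₗ
    TensorProduct.map (j.toLinearMap ∘ₗ antipode k) (targetMap s a b α j ∘ₗ orbitMap k v ∘ₗ
      LinearMap.mulLeft k (IsRMatrix.antipodeDrinfeldInv R))
  have h := congrArg Ψ (P.sum_mul_antipode hR)
  rw [Algebra.TensorProduct.one_def] at h
  simp only [map_sum] at h
  rw [Finset.sum_comm] at h
  refine Eq.trans ?_ (h.trans ?_)
  · refine Finset.sum_congr rfl fun n _ => ?_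
    rw [← sum_antipode_mul_targetMap P hR hf hαj, Finset.mul_sum]
    exact Finset.sum_congr rfl fun i _ => by
      simp [Ψ, mul_smul, antipode_mul_antidistrib, mul_assoc]
  · simp [Ψ]

/-- The inverse of `S(u)` acts on a quantum commutative algebra by an algebra endomorphism. -/
theorem targetMap_antipodeDrinfeldInv_smul_mul [ModuleAlgebra k H V]
    (P : LeftPresentation R f s a b) (hR : IsRMatrix R)
    (hV : IsQuantumCommutative (V := V) R)
    (hf : ∀ (l : L) (v : V), l • v = f l • v) (hαj : IsCovariantPair α j) (v w : V) :
    targetMap s a b α j (IsRMatrix.antipodeDrinfeldInv R • (v * w)) =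
      targetMap s a b α j ((IsRMatrix.antipodeDrinfeldInv R • v) *
        (IsRMatrix.antipodeDrinfeldInv R • w)) := by
  let Φ : L ⊗[k] (H ⊗[k] H) →ₗ[k] T := LinearMap.mul' k T ∘ₗ
    TensorProduct.map (j.toLinearMap ∘ₗ antipode k ∘ₗ antipode k)
      (α.toLinearMap ∘ₗ LinearMap.mul' k V ∘ₗ
        TensorProduct.map (orbitMap k v) (orbitMap k w))
  have hΦ (l : L) (h : H) : Φ (l ⊗ₜ Coalgebra.comul (R := k) h) =
      j (antipode k (antipode k l)) * α (h • (v * w)) := by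
    rw [ModuleAlgebra.smul_mul (k := k)]
    simp only [Φ, LinearMap.comp_apply, TensorProduct.map_tmul, LinearMap.mul'_apply,
      AlgHom.toLinearMap_apply]
    congr 3
    induction Coalgebra.comul (R := k) h with
    | zero => simp
    | add x y hx hy => simp only [map_add, LinearMap.add_apply, hx, hy]
    | tmul x y => simp
  -- Splitting R² by (id ⊗ Δ)(R) = R₁₃R₁₂ builds β(d v) inside the sum for w. It commutes with α(R²
  -- w), so the sum becomes β(d w)β(d v), and the coproduct of u is not used.
  have h := congrArg Φ (P.comul_right hR)
  simp only [map_sum, hΦ] at h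
  rw [targetMap_mul P hR hV hf hαj, ← sum_antipode_antipode_mul_source P hR hf hαj (v * w), h,
    ← sum_antipode_antipode_mul_source P hR hf hαj w, Finset.sum_mul]
  refine Finset.sum_congr rfl fun n _ => ?_
  rw [mul_assoc, ← targetMap_mul_source P hR hV hf hαj,
    ← sum_antipode_antipode_mul_source P hR hf hαj v, Finset.sum_mul, Finset.mul_sum]
  refine Finset.sum_congr rfl fun i _ => ?_
  simp [Φ, mul_assoc, antipode_mul_antidistrib]

end TargetAntipode

theorem IsCovariantPair.of_sum {k L V T : Type*} [Field k] [Ring L] [Bialgebra k L]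
    [Ring V] [Algebra k V] [Module L V] [IsScalarTower k L V] [Ring T] [Algebra k T]
    {α : V →ₐ[k] T} {j : L →ₐ[k] T}
    (h : ∀ (l : L) (v : V), j l * α v =
      ∑ r ∈ (ℛ k l).index, α ((ℛ k l).left r • v) * j ((ℛ k l).right r)) :
    IsCovariantPair α j := by
  intro l v
  rw [h, ← (ℛ k l).eq]
  simp

/-! ### Universal property of the smash product, coaction, and action on V -/

namespace SmashProduct

section Ext

variable {k V L M : Type*} [Field k] [Ring V] [Algebra k V] [Ring L] [Algebra k L]
  [AddCommGroup M] [Module k M]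

theorem linearMap_ext {g h : SmashProduct k V L →ₗ[k] M}
    (H : ∀ (v : V) (l : L), g (mk k v l) = h (mk k v l)) : g = h := by
  have : g ∘ₗ (equiv k V L).toLinearMap = h ∘ₗ (equiv k V L).toLinearMap :=
    TensorProduct.ext' H
  exact LinearMap.ext fun x => LinearMap.congr_fun this x

theorem mk_smul_left (c : k) (v : V) (l : L) : mk k (c • v) l = c • mk k v l :=
  (TensorProduct.smul_tmul' c v l).symm

theorem mk_smul_right (c : k) (v : V) (l : L) : mk k v (c • l) = c • mk k v l :=
  TensorProduct.tmul_smul c v l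

end Ext

section Universal

variable (k V L : Type*) [Field k] [Ring V] [Algebra k V] [Ring L] [Bialgebra k L]
  [Module L V] [IsScalarTower k L V] [ModuleAlgebra k L V]

theorem mk_one_mul_mk (v w : V) (m : L) : mk k v 1 * mk k w m = mk k (v * w) m := by
  rw [mul_def, mk, LinearEquiv.symm_apply_apply, mulHom_tmul, map_one, mul_one]
  simp [mk, leftOp]

theorem mk_mul_one_mk (v : V) (l m : L) : mk k v l * mk k 1 m = mk k v (l * m) := by
  rw [mk_mul_mk k V L v 1 l m (ℛ k l)]
  simp only [ModuleAlgebra.smul_one (k := k), mul_smul_comm, mul_one, mk_smul_left,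
    ← mk_smul_right]
  simp only [← mkHom_apply]
  rw [← map_sum]
  congr 1
  conv_rhs => rw [← Coalgebra.sum_counit_smul (ℛ k l), Finset.sum_mul]
  simp only [smul_mul_assoc]

/-- The embedding `v ↦ v # 1`. -/
def inclLeft : V →ₐ[k] SmashProduct k V L :=
  AlgHom.ofLinearMap ((equiv k V L).toLinearMap ∘ₗ (TensorProduct.mk k V L).flip 1) rfl
    (fun v w => (mk_one_mul_mk k V L v w 1).symm)

/-- The embedding `l ↦ 1 # l`. -/
def inclRight : L →ₐ[k] SmashProduct k V L :=
  AlgHom.ofLinearMap (mkHom k L 1) rfl (fun l m => (mk_mul_one_mk k V L 1 l m).symm)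

variable {V L}

theorem inclLeft_apply (v : V) : inclLeft k V L v = mk k v 1 := rfl

theorem inclRight_apply (l : L) : inclRight k V L l = mk k 1 l := rfl

theorem inclLeft_mul_inclRight (v : V) (l : L) :
    inclLeft k V L v * inclRight k V L l = mk k v l := by
  rw [inclLeft_apply, inclRight_apply, mk_one_mul_mk, mul_one]

theorem isCovariantPair : IsCovariantPair (inclLeft k V L) (inclRight k V L) :=
  IsCovariantPair.of_sum fun l v => by
    simp only [inclLeft_mul_inclRight]
    rw [inclLeft_apply, inclRight_apply, mk_mul_mk k V L 1 v l 1 (ℛ k l)]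
    simp

variable {k} {A : Type*} [Ring A] [Algebra k A]

/-- The universal property of the smash product: a covariant pair extends to an algebra
homomorphism `v # l ↦ α(v) j(l)`. -/
def lift (α : V →ₐ[k] A) (j : L →ₐ[k] A) (h : IsCovariantPair α j) :
    SmashProduct k V L →ₐ[k] A :=
  let φ : SmashProduct k V L →ₗ[k] A := LinearMap.mul' k A ∘ₗ
    TensorProduct.map α.toLinearMap j.toLinearMap ∘ₗ (equiv k V L).symm.toLinearMap
  have hφ (v : V) (l : L) : φ (mk k v l) = α v * j l := rfl
  AlgHom.ofLinearMap φ (by rw [one_def, hφ, map_one, map_one, one_mul]) (by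
    intro x y
    have key : (LinearMap.mul k (SmashProduct k V L)).compr₂ φ =
        (LinearMap.mul k A).compl₁₂ φ φ := by
      refine linearMap_ext fun v l => linearMap_ext fun w m => ?_
      simp only [LinearMap.compr₂_apply, LinearMap.compl₁₂_apply, LinearMap.mul_apply']
      rw [mk_mul_mk k V L v w l m (ℛ k l), map_sum]
      simp only [hφ]
      rw [show α v * j l * (α w * j m) = α v * (j l * α w) * j m by simp only [mul_assoc],
        h.mul_eq_sum l w (ℛ k l), Finset.mul_sum, Finset.sum_mul]
      refine Finset.sum_congr rfl fun r _ => ?_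
      rw [map_mul, map_mul]
      simp only [mul_assoc]
    exact LinearMap.congr_fun₂ key x y)

theorem lift_mk (α : V →ₐ[k] A) (j : L →ₐ[k] A) (h : IsCovariantPair α j) (v : V) (l : L) :
    lift α j h (mk k v l) = α v * j l := rfl

@[simp]
theorem lift_inclLeft (α : V →ₐ[k] A) (j : L →ₐ[k] A) (h : IsCovariantPair α j) (v : V) :
    lift α j h (inclLeft k V L v) = α v := by
  rw [inclLeft_apply, lift_mk, map_one, mul_one]

@[simp]
theorem lift_inclRight (α : V →ₐ[k] A) (j : L →ₐ[k] A) (h : IsCovariantPair α j) (l : L) :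
    lift α j h (inclRight k V L l) = j l := by
  rw [inclRight_apply, lift_mk, map_one, one_mul]

theorem algHom_ext {g h : SmashProduct k V L →ₐ[k] A}
    (h1 : ∀ v : V, g (inclLeft k V L v) = h (inclLeft k V L v))
    (h2 : ∀ l : L, g (inclRight k V L l) = h (inclRight k V L l)) : g = h := by
  refine AlgHom.toLinearMap_injective (linearMap_ext fun v l => ?_)
  simp only [AlgHom.toLinearMap_apply, ← inclLeft_mul_inclRight, map_mul, h1, h2]

variable (k V L)

/-- The coaction `v # l ↦ ∑ (v # l₁) ⊗ (1 # l₂)` with values in `(V # L) ⊗ (V # L)`. -/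
def coaction : SmashProduct k V L →ₐ[k] SmashProduct k V L ⊗[k] SmashProduct k V L :=
  lift (Algebra.TensorProduct.includeLeft.comp (inclLeft k V L))
    ((Algebra.TensorProduct.map (inclRight k V L) (inclRight k V L)).comp
      (Bialgebra.comulAlgHom k L)) (IsCovariantPair.of_sum fun l v => by
    let F : L →ₗ[k] L →ₗ[k] L →ₗ[k] SmashProduct k V L ⊗[k] SmashProduct k V L :=
      { toFun := fun x => (TensorProduct.mk k _ _).compl₁₂
          (LinearMap.mulLeft k (inclLeft k V L (x • v)) ∘ₗ (inclRight k V L).toLinearMap)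
          (inclRight k V L).toLinearMap
        map_add' := fun x y => by ext; simp [add_smul, add_mul]
        map_smul' := fun c x => by ext; simp [TensorProduct.smul_tmul'] }
    have hF (x y z : L) : F x y z =
        (inclLeft k V L (x • v) * inclRight k V L y) ⊗ₜ inclRight k V L z := rfl
    -- Coassociativity turns (l₁₁ v) l₁₂ ⊗ l₂ into (l₁ v) l₂₁ ⊗ l₂₂, which is the covariance
    -- required by `lift`.
    have h := Coalgebra.sum_coassoc F l
    simp only [hF] at h
    refine Eq.trans ?_ (h.trans ?_)
    · simp only [AlgHom.comp_apply, Bialgebra.comulAlgHom_apply]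
      conv_lhs => rw [← (ℛ k l).eq]
      simp only [map_sum, Finset.sum_mul]
      refine Finset.sum_congr rfl fun r _ => ?_
      rw [Algebra.TensorProduct.map_tmul, Algebra.TensorProduct.includeLeft_apply,
        Algebra.TensorProduct.tmul_mul_tmul, mul_one,
        (isCovariantPair k).mul_eq_sum _ v (ℛ k ((ℛ k l).left r)), TensorProduct.sum_tmul]
    · refine Finset.sum_congr rfl fun r _ => ?_
      simp only [AlgHom.comp_apply, Bialgebra.comulAlgHom_apply]
      conv_rhs => rw [← (ℛ k ((ℛ k l).right r)).eq]
      simp [Finset.mul_sum])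

variable {V L}

@[simp]
theorem coaction_inclLeft (v : V) :
    coaction k V L (inclLeft k V L v) = inclLeft k V L v ⊗ₜ 1 := lift_inclLeft _ _ _ v

@[simp]
theorem coaction_inclRight (l : L) : coaction k V L (inclRight k V L l) =
    Algebra.TensorProduct.map (inclRight k V L) (inclRight k V L)
      (Coalgebra.comul (R := k) l) := lift_inclRight _ _ _ l

theorem coaction_mk (v : V) (l : L) : coaction k V L (mk k v l) =
    TensorProduct.map (mkHom k L v) (mkHom k L 1) (Coalgebra.comul (R := k) l) := by
  rw [← inclLeft_mul_inclRight, map_mul, coaction_inclLeft, coaction_inclRight]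
  induction Coalgebra.comul (R := k) l with
  | zero => simp
  | add x y hx hy => simp only [map_add, mul_add, hx, hy]
  | tmul x y =>
    rw [Algebra.TensorProduct.map_tmul, Algebra.TensorProduct.tmul_mul_tmul, one_mul,
      inclLeft_mul_inclRight]
    rfl

variable (V L)

/-- The action `(v # l) x = v (l x)` of `V # L` on `V`. -/
def action : SmashProduct k V L →ₐ[k] Module.End k V :=
  lift (Algebra.lmul k V) (Algebra.lsmul k k V) (IsCovariantPair.of_sum fun l v => by
    ext x
    have h := ModuleAlgebra.smul_mul (k := k) l v x
    rw [← (ℛ k l).eq] at h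
    simpa [LinearMap.sum_apply] using h)

variable {V L}

@[simp]
theorem action_inclLeft (v w : V) : action k V L (inclLeft k V L v) w = v * w := by
  rw [action, lift_inclLeft]; rfl

@[simp]
theorem action_inclRight (l : L) (w : V) : action k V L (inclRight k V L l) w = l • w := by
  rw [action, lift_inclRight]; rfl

end Universal

end SmashProduct

/-! ### Coproducts induced by algebra maps T → T ⊗ T -/

namespace SourceTarget

variable {k : Type u} {B : Type v} {T : Type w} [Field k] [Ring B] [Algebra k B]
  [Ring T] [Algebra k T] (s : SourceTarget k B T)

theorem rightMul_proj (r r' : T) (x : T ⊗[k] T) :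
    s.rightMul r r' (s.proj x) = s.proj (x * (r ⊗ₜ r')) := by
  induction x with
  | zero => simp
  | add x y hx hy => simp only [map_add, add_mul, hx, hy]
  | tmul x y => simp

theorem leftAct_proj (b : B) (x : T ⊗[k] T) :
    s.leftAct b (s.proj x) = s.proj ((s.source b ⊗ₜ 1) * x) := by
  induction x with
  | zero => simp
  | add x y hx hy => simp only [map_add, mul_add, hx, hy]
  | tmul x y => simp

theorem rightAct_proj (b : B) (x : T ⊗[k] T) :
    s.rightAct b (s.proj x) = s.proj ((1 ⊗ₜ s.tgt b) * x) := by
  induction x with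
  | zero => simp
  | add x y hx hy => simp only [map_add, mul_add, hx, hy]
  | tmul x y => simp

/-- The kernel of the projection `T ⊗ T → T ⊗_B T` is a right ideal. -/
theorem proj_mul_congr {x y : T ⊗[k] T} (h : s.proj x = s.proj y) (z : T ⊗[k] T) :
    s.proj (x * z) = s.proj (y * z) := by
  induction z with
  | zero => simp
  | add z w hz hw => simp only [map_add, mul_add, hz, hw]
  | tmul z w => rw [← rightMul_proj, ← rightMul_proj, h]

variable {s} (δ : T →ₐ[k] T ⊗[k] T)

/-- The coproduct `T → T ⊗_B T` induced by a map `T → T ⊗ T`. -/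
def inducedComul (s : SourceTarget k B T) (δ : T →ₐ[k] T ⊗[k] T) : T →ₗ[k] s.TensorSq :=
  s.proj ∘ₗ δ.toLinearMap

theorem inducedComul_apply (t : T) : s.inducedComul δ t = s.proj (δ t) := rfl

variable {δ}

theorem inducedComul_left (h : ∀ b, δ (s.source b) = s.source b ⊗ₜ 1) (b : B) (t : T) :
    s.inducedComul δ (s.source b * t) = s.leftAct b (s.inducedComul δ t) := by
  rw [inducedComul_apply, inducedComul_apply, map_mul, h, leftAct_proj]

theorem inducedComul_right (h : ∀ b, s.proj (δ (s.tgt b)) = s.proj (1 ⊗ₜ s.tgt b)) (b : B)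
    (t : T) : s.inducedComul δ (s.tgt b * t) = s.rightAct b (s.inducedComul δ t) := by
  rw [inducedComul_apply, inducedComul_apply, map_mul, rightAct_proj]
  exact s.proj_mul_congr (h b) _

theorem inducedComul_one : s.inducedComul δ 1 = s.proj (1 ⊗ₜ 1) := by
  rw [inducedComul_apply, map_one]; rfl

/-- Both iterated coproducts are images under T ⊗ T ⊗ T → T ⊗_B T ⊗_B T of the iterates of δ, so
strict coassociativity of δ suffices. -/
theorem inducedComul_coassoc (hl : ∀ (b : B) (t : T),
      s.inducedComul δ (s.source b * t) = s.leftAct b (s.inducedComul δ t))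
    (hr : ∀ (b : B) (t : T),
      s.inducedComul δ (s.tgt b * t) = s.rightAct b (s.inducedComul δ t))
    (h : TensorProduct.assoc k T T T ∘ₗ δ.toLinearMap.rTensor T ∘ₗ δ.toLinearMap =
      δ.toLinearMap.lTensor T ∘ₗ δ.toLinearMap) :
    s.comulTensorId (s.inducedComul δ) hr ∘ₗ s.inducedComul δ =
      s.idTensorComul (s.inducedComul δ) hl ∘ₗ s.inducedComul δ := by
  have h1 : s.comulTensorId (s.inducedComul δ) hr ∘ₗ s.proj =
      s.proj₃ ∘ₗ TensorProduct.assoc k T T T ∘ₗ δ.toLinearMap.rTensor T :=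
    TensorProduct.ext' fun x y => rfl
  have h2 : s.idTensorComul (s.inducedComul δ) hl ∘ₗ s.proj =
      s.proj₃ ∘ₗ δ.toLinearMap.lTensor T :=
    TensorProduct.ext' fun x y => rfl
  calc _ = (s.comulTensorId (s.inducedComul δ) hr ∘ₗ s.proj) ∘ₗ δ.toLinearMap := rfl
    _ = s.proj₃ ∘ₗ (TensorProduct.assoc k T T T ∘ₗ δ.toLinearMap.rTensor T ∘ₗ
        δ.toLinearMap) := by rw [h1]; rfl
    _ = (s.idTensorComul (s.inducedComul δ) hl ∘ₗ s.proj) ∘ₗ δ.toLinearMap := by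
        rw [h, h2]; rfl

/-- Left multiplication by `δ(t)` on `T ⊗_B T`. -/
def coactionMul (h : ∀ (t : T) (b : B),
    s.proj (δ t * (s.tgt b ⊗ₜ 1)) = s.proj (δ t * (1 ⊗ₜ s.source b))) (t : T) :
    s.TensorSq →ₗ[k] s.TensorSq :=
  s.desc (s.proj ∘ₗ LinearMap.mulLeft k (δ t)) (fun b x y => by
    have h1 := s.proj_mul_congr (h t b) (x ⊗ₜ y)
    simpa [mul_assoc] using h1)

/-- φ intertwines left multiplication by t ⊗ r ⊗ r' with the operator x ↦ δ(t) x (r ⊗ r'). The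
Takeuchi condition `h` makes multiplication by δ(t) well defined on T ⊗_B T, so the kernel of φ is a
left ideal. -/
theorem phi_mul (h : ∀ (t : T) (b : B),
    s.proj (δ t * (s.tgt b ⊗ₜ 1)) = s.proj (δ t * (1 ⊗ₜ s.source b)))
    (t : T) (r r' : Tᵐᵒᵖ) (x : T ⊗[k] (Tᵐᵒᵖ ⊗[k] Tᵐᵒᵖ)) :
    s.phi (s.inducedComul δ) ((t ⊗ₜ (r ⊗ₜ r')) * x) =
      coactionMul h t (s.rightMul (unop r) (unop r') (s.phi (s.inducedComul δ) x)) := by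
  have hphi (t : T) (r r' : Tᵐᵒᵖ) : s.phi (s.inducedComul δ) (t ⊗ₜ (r ⊗ₜ r')) =
      s.rightMul (unop r) (unop r') (s.proj (δ t)) := rfl
  have hadd (a x y : T ⊗[k] (Tᵐᵒᵖ ⊗[k] Tᵐᵒᵖ)) : a * (x + y) = a * x + a * y :=
    Distrib.left_distrib a x y
  have hzero (a : T ⊗[k] (Tᵐᵒᵖ ⊗[k] Tᵐᵒᵖ)) : a * 0 = 0 := MulZeroClass.mul_zero a
  induction x with
  | zero => simp only [hzero, map_zero]
  | add x y hx hy => simp only [map_add, hadd, hx, hy]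
  | tmul x y =>
    induction y with
    | zero => simp only [TensorProduct.tmul_zero, hzero, map_zero]
    | add y z hy hz => simp only [map_add, TensorProduct.tmul_add, hadd, hy, hz]
    | tmul y z =>
      have hmul : (t ⊗ₜ[k] (r ⊗ₜ[k] r')) * (x ⊗ₜ[k] (y ⊗ₜ[k] z)) =
        (t * x) ⊗ₜ[k] ((r * y) ⊗ₜ[k] (r' * z)) :=
        (Algebra.TensorProduct.tmul_mul_tmul t x (r ⊗ₜ[k] r') (y ⊗ₜ[k] z)).trans
          (congrArg _ (Algebra.TensorProduct.tmul_mul_tmul r y r' z))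
      rw [hmul, hphi, hphi, rightMul_proj, rightMul_proj, rightMul_proj, map_mul δ, coactionMul,
        desc_proj, LinearMap.comp_apply, LinearMap.mulLeft_apply, mul_assoc, mul_assoc (δ x),
        Algebra.TensorProduct.tmul_mul_tmul, unop_mul, unop_mul]

theorem ker_phi_inducedComul (h : ∀ (t : T) (b : B),
    s.proj (δ t * (s.tgt b ⊗ₜ 1)) = s.proj (δ t * (1 ⊗ₜ s.source b)))
    (a x : T ⊗[k] (Tᵐᵒᵖ ⊗[k] Tᵐᵒᵖ)) (hx : s.phi (s.inducedComul δ) x = 0) :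
    s.phi (s.inducedComul δ) (a * x) = 0 := by
  have hadd (a b : T ⊗[k] (Tᵐᵒᵖ ⊗[k] Tᵐᵒᵖ)) : (a + b) * x = a * x + b * x :=
    Distrib.right_distrib a b x
  have hzero : (0 : T ⊗[k] (Tᵐᵒᵖ ⊗[k] Tᵐᵒᵖ)) * x = 0 := MulZeroClass.zero_mul x
  induction a with
  | zero => rw [hzero, map_zero]
  | add a b ha hb => rw [hadd, map_add, ha, hb, add_zero]
  | tmul t y =>
    induction y with
    | zero => rw [TensorProduct.tmul_zero, hzero, map_zero]
    | add a b ha hb => rw [TensorProduct.tmul_add, hadd, map_add, ha, hb, add_zero]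
    | tmul r r' => rw [phi_mul h, hx, map_zero, map_zero]

end SourceTarget

/-! ### The bialgebroid V # L -/

namespace SmashProduct

open HopfAlgebra

variable {k L H V ι : Type*} [Field k] [Ring L] [HopfAlgebra k L]
  [Ring H] [HopfAlgebra k H] {R : H ⊗[k] H} {f : L →ₐ[k] H} {s : Finset ι} {a : ι → L}
  {b : ι → H} [Ring V] [Algebra k V] [Module H V] [IsScalarTower k H V] [ModuleAlgebra k H V]
  [Module L V] [IsScalarTower k L V] [ModuleAlgebra k L V]
  (P : LeftPresentation R f s a b) (hR : IsRMatrix R)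
  (hV : IsQuantumCommutative (V := V) R) (hf : ∀ (l : L) (v : V), l • v = f l • v)

/-- Source and target map of `V # L`. -/
def sourceTarget : SourceTarget k V (SmashProduct k V L) where
  source := inclLeft k V L
  target := AlgHom.ofLinearMap
    ((opLinearEquiv k).toLinearMap ∘ₗ targetMap s a b (inclLeft k V L) (inclRight k V L))
    (unop_injective (targetMap_one P hR))
    (fun v w => unop_injective (targetMap_mul P hR hV hf (isCovariantPair k) w v))
  commute v w := (targetMap_mul_source P hR hV hf (isCovariantPair k) v w).symm

theorem sourceTarget_tgt (v : V) : (sourceTarget P hR hV hf).tgt v =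
    targetMap s a b (inclLeft k V L) (inclRight k V L) v := rfl

theorem sourceTarget_tgt_one : (sourceTarget P hR hV hf).tgt 1 = 1 := targetMap_one P hR

theorem sourceTarget_tgt_eq_sum (v : V) : (sourceTarget P hR hV hf).tgt v =
    ∑ i ∈ s, mk k (b i • v) (a i) := by
  simp only [sourceTarget_tgt, targetMap_apply, inclLeft_mul_inclRight]

theorem sourceTarget_source (v : V) :
    (sourceTarget P hR hV hf).source v = inclLeft k V L v := rfl

theorem inclRight_mul_tgt (l : L) (v : V) :
    inclRight k V L l * (sourceTarget P hR hV hf).tgt v = ∑ r ∈ (ℛ k l).index,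
      (sourceTarget P hR hV hf).tgt ((ℛ k l).right r • v) * inclRight k V L ((ℛ k l).left r) :=
  mul_targetMap P hR hf (isCovariantPair k) l v

/-- The action of ∑ (R² v) # R¹ on w is ∑ (R² v)(R¹ w), which is w v by quantum commutativity. Both
the right linearity of the counit and the injectivity of β rest on this. -/
theorem action_tgt (v w : V) : action k V L ((sourceTarget P hR hV hf).tgt v) w = w * v := by
  rw [sourceTarget_tgt, targetMap_apply, map_sum, LinearMap.sum_apply, ← hV.mul_eq_sum P]
  refine Finset.sum_congr rfl fun i _ => ?_
  rw [map_mul, Module.End.mul_apply, action_inclRight, action_inclLeft, hf]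

theorem tgt_injective : Function.Injective (sourceTarget P hR hV hf).tgt := by
  intro v w h
  have h' := congrArg (fun t => action k V L t 1) h
  simpa only [action_tgt, one_mul] using h'

/-- (Δ ⊗ id)(R) = R₁₃R₂₃ collects one copy of R into β(R² v) ⊗ j(R¹); balancing moves it across as 1
⊗ α(R² v) j(R¹). -/
theorem proj_coaction_tgt (v : V) : (sourceTarget P hR hV hf).proj
    (coaction k V L ((sourceTarget P hR hV hf).tgt v)) =
    (sourceTarget P hR hV hf).proj (1 ⊗ₜ (sourceTarget P hR hV hf).tgt v) := by
  let Φ : (L ⊗[k] L) ⊗[k] H →ₗ[k] SmashProduct k V L ⊗[k] SmashProduct k V L :=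
    LinearMap.mul' k _ ∘ₗ TensorProduct.map
      ((TensorProduct.mk k _ _).flip 1 ∘ₗ (inclLeft k V L).toLinearMap ∘ₗ orbitMap k v)
      (TensorProduct.map (inclRight k V L).toLinearMap (inclRight k V L).toLinearMap) ∘ₗ
      (TensorProduct.comm k (L ⊗[k] L) H).toLinearMap
  have hΦ (x y : L) (h : H) : Φ ((x ⊗ₜ y) ⊗ₜ h) =
      (inclLeft k V L (h • v) * inclRight k V L x) ⊗ₜ inclRight k V L y := by
    simp [Φ]
  have h := congrArg Φ (P.comul_left hR)
  have h1 : coaction k V L ((sourceTarget P hR hV hf).tgt v) =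
      Φ (∑ i ∈ s, Coalgebra.comul (R := k) (a i) ⊗ₜ[k] b i) := by
    rw [sourceTarget_tgt, targetMap_apply, map_sum, map_sum]
    refine Finset.sum_congr rfl fun i _ => ?_
    rw [map_mul, coaction_inclLeft, coaction_inclRight]
    rfl
  rw [h1, h, Finset.sum_comm, sourceTarget_tgt, targetMap_apply, TensorProduct.tmul_sum]
  simp only [map_sum]
  refine Finset.sum_congr rfl fun n _ => ?_
  have h2 := (sourceTarget P hR hV hf).proj_balanced (b n • v) 1 (inclRight k V L (a n))
  rw [mul_one, sourceTarget_source] at h2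
  rw [← h2, sourceTarget_tgt, targetMap_apply, TensorProduct.sum_tmul, map_sum]
  exact Finset.sum_congr rfl fun i _ => by rw [hΦ, mul_smul]

/-- Takeuchi's condition on the generators from L. The exchange rule for β gives β(l₂ v) l₁ ⊗ l₃;
balancing turns it into l₁ ⊗ α(l₂ v) l₃, which is l₁ ⊗ l₂ α(v) by covariance. -/
theorem proj_coaction_inclRight_mul (l : L) (v : V) : (sourceTarget P hR hV hf).proj
    (coaction k V L (inclRight k V L l) * ((sourceTarget P hR hV hf).tgt v ⊗ₜ 1)) =
    (sourceTarget P hR hV hf).proj (coaction k V L (inclRight k V L l) *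
      (1 ⊗ₜ (sourceTarget P hR hV hf).source v)) := by
  set S := sourceTarget P hR hV hf with hS
  let F : L →ₗ[k] L →ₗ[k] L →ₗ[k] S.TensorSq :=
    { toFun := fun x => ((TensorProduct.mk k _ _).compl₁₂
        (LinearMap.mulRight k (inclRight k V L x) ∘ₗ S.tgt ∘ₗ orbitMap k v)
          (inclRight k V L).toLinearMap).compr₂ S.proj
      map_add' := fun x y => by ext; simp [mul_add]
      map_smul' := fun c x => by ext; simp }
  have hF (x y z : L) : F x y z =
      S.proj ((S.tgt (y • v) * inclRight k V L x) ⊗ₜ inclRight k V L z) := rfl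
  have h := Coalgebra.sum_coassoc F l
  simp only [hF] at h
  have hc : coaction k V L (inclRight k V L l) = ∑ r ∈ (ℛ k l).index,
      inclRight k V L ((ℛ k l).left r) ⊗ₜ inclRight k V L ((ℛ k l).right r) := by
    rw [coaction_inclRight]
    conv_lhs => rw [← (ℛ k l).eq]
    simp
  rw [hc, Finset.sum_mul, Finset.sum_mul, map_sum, map_sum]
  refine Eq.trans ?_ (h.trans ?_)
  · refine Finset.sum_congr rfl fun r _ => ?_
    rw [Algebra.TensorProduct.tmul_mul_tmul, mul_one, inclRight_mul_tgt, TensorProduct.sum_tmul,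
      map_sum]
  · refine Finset.sum_congr rfl fun r _ => ?_
    rw [Algebra.TensorProduct.tmul_mul_tmul, mul_one, hS, sourceTarget_source,
      (isCovariantPair k).mul_eq_sum _ v (ℛ k ((ℛ k l).right r)), TensorProduct.tmul_sum, map_sum]
    refine Finset.sum_congr rfl fun q _ => ?_
    rw [SourceTarget.proj_balanced]
    rfl

theorem proj_coaction_mul (t : SmashProduct k V L) (v : V) : (sourceTarget P hR hV hf).proj
    (coaction k V L t * ((sourceTarget P hR hV hf).tgt v ⊗ₜ 1)) =
    (sourceTarget P hR hV hf).proj (coaction k V L t *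
      (1 ⊗ₜ (sourceTarget P hR hV hf).source v)) := by
  let g (z : SmashProduct k V L ⊗[k] SmashProduct k V L) :=
    (sourceTarget P hR hV hf).proj ∘ₗ LinearMap.mulRight k z ∘ₗ (coaction k V L).toLinearMap
  have h : g ((sourceTarget P hR hV hf).tgt v ⊗ₜ 1) =
      g (1 ⊗ₜ (sourceTarget P hR hV hf).source v) := by
    refine linearMap_ext fun w l => ?_
    simp only [g, LinearMap.comp_apply, AlgHom.toLinearMap_apply, LinearMap.mulRight_apply,
      ← inclLeft_mul_inclRight, map_mul, coaction_inclLeft, mul_assoc]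
    rw [← sourceTarget_source P hR hV hf w, ← SourceTarget.leftAct_proj,
      ← SourceTarget.leftAct_proj, proj_coaction_inclRight_mul]
  exact LinearMap.congr_fun h t

theorem coaction_coassoc :
    (TensorProduct.assoc k (SmashProduct k V L) (SmashProduct k V L)
      (SmashProduct k V L)).toLinearMap ∘ₗ (coaction k V L).toLinearMap.rTensor _ ∘ₗ
      (coaction k V L).toLinearMap =
    (coaction k V L).toLinearMap.lTensor _ ∘ₗ (coaction k V L).toLinearMap := by
  have h : (Algebra.TensorProduct.assoc k k k _ _ _).toAlgHom.comp
      ((Algebra.TensorProduct.map (coaction k V L) (AlgHom.id k _)).comp (coaction k V L)) =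
      (Algebra.TensorProduct.map (AlgHom.id k _) (coaction k V L)).comp (coaction k V L) := by
    -- Both sides are algebra homomorphisms, so the generators suffice; on L the claim is the
    -- coassociativity of L.
    refine algHom_ext (fun v => ?_) (fun l => ?_)
    · simp [Algebra.TensorProduct.one_def]
    · let J : L ⊗[k] (L ⊗[k] L) →ₗ[k] _ := TensorProduct.map (inclRight k V L).toLinearMap
        (TensorProduct.map (inclRight k V L).toLinearMap (inclRight k V L).toLinearMap)
      have h1 (z : L ⊗[k] L) : Algebra.TensorProduct.assoc k k k _ _ _
          (Algebra.TensorProduct.map (coaction k V L) (AlgHom.id k _)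
            (Algebra.TensorProduct.map (inclRight k V L) (inclRight k V L) z)) =
          J (TensorProduct.assoc k L L L (Coalgebra.comul.rTensor L z)) := by
        induction z with
        | zero => simp
        | add x y hx hy => simp only [map_add, hx, hy]
        | tmul x y =>
          simp only [Algebra.TensorProduct.map_tmul, coaction_inclRight, LinearMap.rTensor_tmul,
            AlgHom.id_apply]
          induction Coalgebra.comul (R := k) x with
          | zero => simp
          | add x y hx hy => simp only [map_add, TensorProduct.add_tmul, hx, hy]
          | tmul x z => rfl
      have h2 (z : L ⊗[k] L) : Algebra.TensorProduct.map (AlgHom.id k _) (coaction k V L)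
            (Algebra.TensorProduct.map (inclRight k V L) (inclRight k V L) z) =
          J (Coalgebra.comul.lTensor L z) := by
        induction z with
        | zero => simp
        | add x y hx hy => simp only [map_add, hx, hy]
        | tmul x y =>
          simp only [Algebra.TensorProduct.map_tmul, coaction_inclRight, LinearMap.lTensor_tmul,
            AlgHom.id_apply]
          rfl
      have h3 := h1 (Coalgebra.comul (R := k) l)
      rw [Coalgebra.coassoc_apply, ← h2, ← coaction_inclRight] at h3
      exact h3
  exact congrArg AlgHom.toLinearMap h

/-- The counit `v # l ↦ ε(l) v`. -/
def counit : SmashProduct k V L →ₗ[k] V :=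
  LinearMap.applyₗ (1 : V) ∘ₗ (action k V L).toLinearMap

theorem counit_eq_action (t : SmashProduct k V L) : counit t = action k V L t 1 := rfl

theorem counit_mk (v : V) (l : L) : counit (mk k v l) = Coalgebra.counit (R := k) l • v := by
  rw [counit_eq_action, ← inclLeft_mul_inclRight, map_mul, Module.End.mul_apply,
    action_inclRight, action_inclLeft, ModuleAlgebra.smul_one (k := k), mul_smul_comm, mul_one]

/-- The counit is the orbit map of 1 ∈ V for the action of V # L. Its kernel is the annihilator of
1, hence a left ideal. -/
theorem counit_mul (x y : SmashProduct k V L) : counit (x * y) = action k V L x (counit y) := by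
  rw [counit_eq_action, map_mul]; rfl

theorem counit_source_mul (v : V) (t : SmashProduct k V L) :
    counit ((sourceTarget P hR hV hf).source v * t) = v * counit t := by
  rw [counit_mul, sourceTarget_source, action_inclLeft]

theorem counit_tgt_mul (v : V) (t : SmashProduct k V L) :
    counit ((sourceTarget P hR hV hf).tgt v * t) = counit t * v := by
  rw [counit_mul, action_tgt]

theorem counitTensorId_comp_comul :
    (sourceTarget P hR hV hf).counitTensorId counit (counit_tgt_mul P hR hV hf) ∘ₗ
      (sourceTarget P hR hV hf).inducedComul (coaction k V L) = LinearMap.id := by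
  refine linearMap_ext fun v l => ?_
  rw [LinearMap.comp_apply, SourceTarget.inducedComul_apply, coaction_mk, ← (ℛ k l).eq,
    LinearMap.id_apply]
  simp only [map_sum, TensorProduct.map_tmul, mkHom_apply]
  have h (x y : L) : (sourceTarget P hR hV hf).counitTensorId counit (counit_tgt_mul P hR hV hf)
      ((sourceTarget P hR hV hf).proj (mk k v x ⊗ₜ mk k 1 y)) =
      mkHom k L v (Coalgebra.counit (R := k) x • y) := by
    change inclLeft k V L (counit (mk k v x)) * inclRight k V L y = _
    rw [counit_mk, inclLeft_mul_inclRight, mk_smul_left, map_smul]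
    rfl
  simp only [h]
  rw [← map_sum, Coalgebra.sum_counit_smul]
  rfl

theorem idTensorCounit_comp_comul :
    (sourceTarget P hR hV hf).idTensorCounit counit (counit_source_mul P hR hV hf) ∘ₗ
      (sourceTarget P hR hV hf).inducedComul (coaction k V L) = LinearMap.id := by
  refine linearMap_ext fun v l => ?_
  rw [LinearMap.comp_apply, SourceTarget.inducedComul_apply, coaction_mk, ← (ℛ k l).eq,
    LinearMap.id_apply]
  simp only [map_sum, TensorProduct.map_tmul, mkHom_apply]
  have h (x y : L) : (sourceTarget P hR hV hf).idTensorCounit counit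
      (counit_source_mul P hR hV hf)
      ((sourceTarget P hR hV hf).proj (mk k v x ⊗ₜ mk k 1 y)) =
      mkHom k L v (Coalgebra.counit (R := k) y • x) := by
    change (sourceTarget P hR hV hf).tgt (counit (mk k (1 : V) y)) * mk k v x = _
    rw [counit_mk, map_smul, sourceTarget_tgt_one, smul_mul_assoc, one_mul, map_smul]
    rfl
  simp only [h]
  have h2 := congrArg (TensorProduct.rid k L) (Coalgebra.sum_tmul_counit_eq (ℛ k l))
  simp only [map_sum, TensorProduct.rid_tmul, one_smul] at h2
  rw [← map_sum, h2]
  rfl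

/-- The bialgebroid structure of `V # L`. -/
def bialgebroid : Bialgebroid k V (SmashProduct k V L) where
  toSourceTarget := sourceTarget P hR hV hf
  comul := (sourceTarget P hR hV hf).inducedComul (coaction k V L)
  comul_left := SourceTarget.inducedComul_left (coaction_inclLeft k)
  comul_right := SourceTarget.inducedComul_right (proj_coaction_tgt P hR hV hf)
  comul_one := SourceTarget.inducedComul_one
  coassoc := SourceTarget.inducedComul_coassoc _ _ coaction_coassoc
  ker_phi_leftIdeal := SourceTarget.ker_phi_inducedComul (proj_coaction_mul P hR hV hf)
  counit := counit
  counit_left := counit_source_mul P hR hV hf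
  counit_right := counit_tgt_mul P hR hV hf
  counit_one := by rw [counit_eq_action, map_one (action k V L)]; rfl
  counit_tensor_id := counitTensorId_comp_comul P hR hV hf
  id_tensor_counit := idTensorCounit_comp_comul P hR hV hf
  ker_counit_leftIdeal x t h := by rw [counit_mul, h, map_zero]

end SmashProduct

/-! ### The antipode of V # L -/

theorem LeftPresentation.antipodeDrinfeldInv_smul_smul {k L H V ι : Type*} [Field k] [Ring L]
    [HopfAlgebra k L] [Ring H] [HopfAlgebra k H] {R : H ⊗[k] H} {f : L →ₐ[k] H} {s : Finset ι}
    {a : ι → L} {b : ι → H} [AddCommGroup V] [Module H V] [Module L V] (P : LeftPresentation R f s a b) (hR : IsRMatrix R)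
    (hf : ∀ (l : L) (v : V), l • v = f l • v) (l : L) (v : V) :
    IsRMatrix.antipodeDrinfeldInv R • l • v =
      HopfAlgebra.antipode k (HopfAlgebra.antipode k l) • IsRMatrix.antipodeDrinfeldInv R • v := by
  rw [hf, hf, ← mul_smul, hR.antipodeDrinfeldInv_mul, P.map_antipode, P.map_antipode, mul_smul]

namespace SmashProduct

open HopfAlgebra

variable {k L H V ι : Type*} [Field k] [Ring L] [HopfAlgebra k L]
  [Ring H] [HopfAlgebra k H] {R : H ⊗[k] H} {f : L →ₐ[k] H} {s : Finset ι} {a : ι → L}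
  {b : ι → H} [Ring V] [Algebra k V] [Module H V] [IsScalarTower k H V] [ModuleAlgebra k H V]
  [Module L V] [IsScalarTower k L V] [ModuleAlgebra k L V]

theorem antipodeDrinfeldInv_smul_mul (P : LeftPresentation R f s a b) (hR : IsRMatrix R)
    (hV : IsQuantumCommutative (V := V) R) (hf : ∀ (l : L) (v : V), l • v = f l • v) (v w : V) :
    IsRMatrix.antipodeDrinfeldInv R • (v * w) =
    (IsRMatrix.antipodeDrinfeldInv R • v) * (IsRMatrix.antipodeDrinfeldInv R • w) :=
  tgt_injective P hR hV hf
    (targetMap_antipodeDrinfeldInv_smul_mul P hR hV hf (isCovariantPair k) v w)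

variable (P : LeftPresentation R f s a b) (hR : IsRMatrix R)
  (hV : IsQuantumCommutative (V := V) R) (hf : ∀ (l : L) (v : V), l • v = f l • v)

/-- The action of the inverse of `S(u)` as an algebra endomorphism of `V`. -/
def antipodeDrinfeldInvAlgHom : V →ₐ[k] V :=
  AlgHom.ofLinearMap (Algebra.lsmul k k V (IsRMatrix.antipodeDrinfeldInv R))
    (by
      -- Multiplicativity on 1 · (d⁻¹ 1) gives 1 = (d 1) · 1, so d fixes the unit.
      have h := antipodeDrinfeldInv_smul_mul P hR hV hf 1 (IsRMatrix.mulAntipode R • (1 : V))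
      rw [one_mul, ← mul_smul, hR.antipodeDrinfeldInv_mul_mulAntipode, one_smul, mul_one] at h
      exact h.symm)
    (antipodeDrinfeldInv_smul_mul P hR hV hf)

/-- In the opposite algebra covariance reads β(d v) j(S(l)) = ∑ j(S(l₂)) β(d l₁ v). Through d l₁ =
S²(l₁) d this is `sum_antipode_mul_targetMap_antipode`. -/
theorem isCovariantPair_antipode : IsCovariantPair
    ((sourceTarget P hR hV hf).target.comp (antipodeDrinfeldInvAlgHom P hR hV hf))
    ((AlgHom.op (inclRight k V L)).comp (antipodeAlgHomOp k L)) :=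
  IsCovariantPair.of_sum fun l v => unop_injective (by
    have h := sum_antipode_mul_targetMap_antipode P hR hf (isCovariantPair k) l
      (IsRMatrix.antipodeDrinfeldInv R • v)
    rw [unop_mul, Finset.unop_sum]
    refine h.symm.trans (Finset.sum_congr rfl fun r _ => ?_)
    rw [← P.antipodeDrinfeldInv_smul_smul hR hf]
    rfl)

/-- The antipode of `V # L` as a homomorphism into the opposite algebra. -/
def antipodeOp : SmashProduct k V L →ₐ[k] (SmashProduct k V L)ᵐᵒᵖ :=
  lift _ _ (isCovariantPair_antipode P hR hV hf)

/-- The antipode of `V # L`. -/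
def antipodeMap : SmashProduct k V L →ₗ[k] SmashProduct k V L :=
  (opLinearEquiv k).symm.toLinearMap ∘ₗ (antipodeOp P hR hV hf).toLinearMap

theorem antipodeMap_mul (x y : SmashProduct k V L) : antipodeMap P hR hV hf (x * y) =
    antipodeMap P hR hV hf y * antipodeMap P hR hV hf x := by
  simp [antipodeMap]

theorem antipodeMap_inclLeft (v : V) : antipodeMap P hR hV hf (inclLeft k V L v) =
    (sourceTarget P hR hV hf).tgt (IsRMatrix.antipodeDrinfeldInv R • v) :=
  congrArg unop (lift_inclLeft _ _ (isCovariantPair_antipode P hR hV hf) v)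

theorem antipodeMap_inclRight (l : L) : antipodeMap P hR hV hf (inclRight k V L l) =
    inclRight k V L (antipode k l) :=
  congrArg unop (lift_inclRight _ _ (isCovariantPair_antipode P hR hV hf) l)

theorem antipodeMap_mk (v : V) (l : L) : antipodeMap P hR hV hf (mk k v l) =
    inclRight k V L (antipode k l) *
      (sourceTarget P hR hV hf).tgt (IsRMatrix.antipodeDrinfeldInv R • v) := by
  rw [← inclLeft_mul_inclRight, antipodeMap_mul, antipodeMap_inclLeft, antipodeMap_inclRight]

theorem antipodeMap_tgt (v : V) :
    antipodeMap P hR hV hf ((sourceTarget P hR hV hf).tgt v) = inclLeft k V L v := by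
  rw [sourceTarget_tgt_eq_sum, map_sum, ← sum_antipode_mul_targetMap P hR hf (isCovariantPair k)]
  exact Finset.sum_congr rfl fun i _ => antipodeMap_mk P hR hV hf _ _

/-- τ reverses j(S(l)) β(d v), and τβ = α turns β(d v) into α(d v). So τ² is the tensor product of
the action of d with S². -/
theorem antipodeMap_antipodeMap_mk (v : V) (l : L) :
    antipodeMap P hR hV hf (antipodeMap P hR hV hf (mk k v l)) =
      mk k (IsRMatrix.antipodeDrinfeldInv R • v) (antipode k (antipode k l)) := by
  rw [antipodeMap_mk, antipodeMap_mul, antipodeMap_tgt, antipodeMap_inclRight,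
    inclLeft_mul_inclRight]

/-- τ² is bijective, since d is invertible in H and S² is bijective on L; hence τ is both injective
and surjective. -/
theorem antipodeMap_bijective
    (hL : Function.Bijective (antipode k ∘ₗ antipode k : L →ₗ[k] L)) :
    Function.Bijective (antipodeMap P hR hV hf) := by
  let e : V ≃ₗ[k] V := LinearEquiv.ofLinearMap
    (Algebra.lsmul k k V (IsRMatrix.antipodeDrinfeldInv R))
    (Algebra.lsmul k k V (IsRMatrix.mulAntipode R))
    (by ext v; simp [← mul_smul, hR.antipodeDrinfeldInv_mul_mulAntipode])
    (by ext v; simp [← mul_smul, hR.mulAntipode_mul_antipodeDrinfeldInv])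
  let E : SmashProduct k V L ≃ₗ[k] SmashProduct k V L :=
    (equiv k V L).symm ≪≫ₗ TensorProduct.congr e (LinearEquiv.ofBijective _ hL) ≪≫ₗ equiv k V L
  have h : antipodeMap P hR hV hf ∘ₗ antipodeMap P hR hV hf = E.toLinearMap :=
    linearMap_ext fun v l => antipodeMap_antipodeMap_mk P hR hV hf v l
  have h' : antipodeMap P hR hV hf ∘ antipodeMap P hR hV hf = E :=
    funext fun x => LinearMap.congr_fun h x
  constructor
  · exact Function.Injective.of_comp (h' ▸ E.injective)
  · exact Function.Surjective.of_comp (h' ▸ E.surjective)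

theorem antipodeMulId_comp_comul :
    (sourceTarget P hR hV hf).antipodeMulId (antipodeMap P hR hV hf)
      (antipodeMap_mul P hR hV hf) (antipodeMap_tgt P hR hV hf) ∘ₗ
      (sourceTarget P hR hV hf).inducedComul (coaction k V L) =
    (sourceTarget P hR hV hf).tgt ∘ₗ counit ∘ₗ antipodeMap P hR hV hf := by
  refine linearMap_ext fun v l => ?_
  simp only [LinearMap.comp_apply, antipodeMap_mk]
  rw [SourceTarget.inducedComul_apply, coaction_mk, ← (ℛ k l).eq, counit_mul, action_inclRight,
    counit_eq_action, action_tgt, one_mul]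
  simp only [map_sum, TensorProduct.map_tmul, mkHom_apply]
  rw [sourceTarget_tgt, ← sum_antipode_mul_targetMap_mul P hR hf (isCovariantPair k)]
  refine Finset.sum_congr rfl fun r _ => ?_
  change antipodeMap P hR hV hf (mk k v ((ℛ k l).left r)) * inclRight k V L ((ℛ k l).right r) = _
  rw [antipodeMap_mk, sourceTarget_tgt]

/-- The linear map `t ⊗ (w # m) ↦ β(w) t ⊗ (1 # m)`. -/
def normalize : SmashProduct k V L ⊗[k] SmashProduct k V L →ₗ[k]
    SmashProduct k V L ⊗[k] SmashProduct k V L :=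
  TensorProduct.lift (LinearMap.flip (TensorProduct.lift (LinearMap.mk₂ k
    (fun (v : V) (l : L) => (TensorProduct.mk k _ _).flip (inclRight k V L l) ∘ₗ
      LinearMap.mulLeft k ((sourceTarget P hR hV hf).tgt v))
    (fun v w l => by ext; simp [add_mul])
    (fun c v l => by ext; simp [TensorProduct.smul_tmul'])
    (fun v l m => by ext; simp)
    (fun c v l => by ext; simp)) ∘ₗ (equiv k V L).symm.toLinearMap))

theorem normalize_tmul (t : SmashProduct k V L) (v : V) (l : L) :
    normalize P hR hV hf (t ⊗ₜ mk k v l) =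
      ((sourceTarget P hR hV hf).tgt v * t) ⊗ₜ inclRight k V L l := rfl

/-- The section `t ⊗ (w # m) ↦ β(w) t ⊗ (1 # m)` of the projection `T ⊗ T → T ⊗_V T`. -/
def tensorSection : (sourceTarget P hR hV hf).TensorSq →ₗ[k]
    SmashProduct k V L ⊗[k] SmashProduct k V L :=
  (sourceTarget P hR hV hf).desc (normalize P hR hV hf) (fun v t t' => by
    -- Well defined on T ⊗_V T because β(w)β(v) = β(vw).
    have h : normalize P hR hV hf ∘ₗ
        TensorProduct.mk k _ _ ((sourceTarget P hR hV hf).tgt v * t) =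
        normalize P hR hV hf ∘ₗ TensorProduct.mk k _ _ t ∘ₗ
          LinearMap.mulLeft k ((sourceTarget P hR hV hf).source v) := by
      refine linearMap_ext fun w l => ?_
      simp only [LinearMap.comp_apply, TensorProduct.mk_apply, LinearMap.mulLeft_apply,
        sourceTarget_source]
      rw [inclLeft_apply, mk_one_mul_mk, normalize_tmul, normalize_tmul, SourceTarget.tgt_mul,
        mul_assoc]
    exact LinearMap.congr_fun h t')

theorem proj_comp_tensorSection :
    (sourceTarget P hR hV hf).proj ∘ₗ tensorSection P hR hV hf = LinearMap.id := by
  refine SourceTarget.hom_ext _ fun t t' => ?_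
  have h : (sourceTarget P hR hV hf).proj ∘ₗ normalize P hR hV hf ∘ₗ TensorProduct.mk k _ _ t =
      (sourceTarget P hR hV hf).proj ∘ₗ TensorProduct.mk k _ _ t := by
    refine linearMap_ext fun v l => ?_
    simp only [LinearMap.comp_apply, TensorProduct.mk_apply]
    rw [normalize_tmul, SourceTarget.proj_balanced, sourceTarget_source, inclLeft_mul_inclRight]
  exact LinearMap.congr_fun h t'

/-- The representatives (v # l₁) ⊗ (1 # l₂) are already normalized, so the section fixes them and
only ∑ l₁S(l₂) = ε(l) remains. -/
theorem mul_antipode_tensorSection_comul :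
    LinearMap.mul' k (SmashProduct k V L) ∘ₗ
      TensorProduct.map LinearMap.id (antipodeMap P hR hV hf) ∘ₗ tensorSection P hR hV hf ∘ₗ
      (sourceTarget P hR hV hf).inducedComul (coaction k V L) =
    (sourceTarget P hR hV hf).source.toLinearMap ∘ₗ counit := by
  refine linearMap_ext fun v l => ?_
  simp only [LinearMap.comp_apply]
  rw [SourceTarget.inducedComul_apply, coaction_mk, ← (ℛ k l).eq, counit_mk]
  simp only [map_sum, TensorProduct.map_tmul, mkHom_apply]
  have h (x y : L) : LinearMap.mul' k (SmashProduct k V L)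
      (TensorProduct.map LinearMap.id (antipodeMap P hR hV hf) (tensorSection P hR hV hf
        ((sourceTarget P hR hV hf).proj (mk k v x ⊗ₜ mk k 1 y)))) =
      inclLeft k V L v * inclRight k V L (x * antipode k y) := by
    change LinearMap.mul' k (SmashProduct k V L)
      (TensorProduct.map LinearMap.id (antipodeMap P hR hV hf) (normalize P hR hV hf
        (mk k v x ⊗ₜ mk k 1 y))) = _
    rw [normalize_tmul, sourceTarget_tgt_one, one_mul, TensorProduct.map_tmul,
      LinearMap.mul'_apply, antipodeMap_inclRight, LinearMap.id_apply, ← inclLeft_mul_inclRight,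
      mul_assoc, map_mul]
  simp only [h]
  rw [← Finset.mul_sum, ← map_sum, sum_mul_antipode_eq_smul, map_smul, map_one, mul_smul_comm,
    mul_one, map_smul]
  rfl

/-- The Hopf algebroid structure of `V # L`. -/
def hopfAlgebroid (hL : Function.Bijective (antipode k ∘ₗ antipode k : L →ₗ[k] L)) :
    HopfAlgebroid k V (SmashProduct k V L) where
  toBialgebroid := bialgebroid P hR hV hf
  antipode := antipodeMap P hR hV hf
  antipode_bijective := antipodeMap_bijective P hR hV hf hL
  antipode_one := by
    have h := antipodeMap_inclRight P hR hV hf 1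
    rwa [antipode_one, map_one] at h
  antipode_mul := antipodeMap_mul P hR hV hf
  antipode_tgt := antipodeMap_tgt P hR hV hf
  antipode_mul_id := antipodeMulId_comp_comul P hR hV hf
  exists_section := ⟨tensorSection P hR hV hf, proj_comp_tensorSection P hR hV hf,
    mul_antipode_tensorSection_comul P hR hV hf⟩

end SmashProduct

/-! ### Application to the Hopf subalgebra R₍ₗ₎ -/

namespace IsRMatrix

open HopfAlgebra

variable {k H : Type*} [Field k] [Ring H] [HopfAlgebra k H] {R : H ⊗[k] H}

theorem exists_leftPresentation (hR : IsRMatrix R) :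
    ∃ (s : Finset (hR.leftHopfSubalgebra × H)),
      LeftPresentation R hR.leftHopfSubalgebra.toSubalgebra.val s Prod.fst Prod.snd := by
  obtain ⟨R', hR'⟩ := hR.exists_lift
  obtain ⟨s, hs⟩ := TensorProduct.exists_finset R'
  refine ⟨s, Subtype.val_injective, fun l => hR.leftHopfSubalgebra.incl₂_comul l,
    fun l => rfl, ?_⟩
  have h := congrArg (hR.leftSubalgebra.val.toLinearMap.rTensor H) hs
  rw [map_sum] at h
  exact h.symm.trans hR'

/-- Injectivity is inherited from H. Surjectivity is not, as d need not lie in L; it follows from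
finite dimension. -/
theorem leftHopfSubalgebra_antipode_antipode_bijective (hR : IsRMatrix R) :
    Function.Bijective (antipode k ∘ₗ antipode k :
      hR.leftHopfSubalgebra →ₗ[k] hR.leftHopfSubalgebra) := by
  have : FiniteDimensional k hR.leftHopfSubalgebra := finite_leftSubalgebra hR
  have hinj : Function.Injective (antipode k ∘ₗ antipode k :
      hR.leftHopfSubalgebra →ₗ[k] hR.leftHopfSubalgebra) := fun x y h =>
    Subtype.ext (hR.antipode_antipode_bijective.1 (congrArg Subtype.val h))
  exact ⟨hinj, LinearMap.injective_iff_surjective.1 hinj⟩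

end IsRMatrix

end

theorem theorem5p8 {k H V : Type*} [Field k] [Ring H] [HopfAlgebra k H]
    (R : H ⊗[k] H) (hR : IsRMatrix R)
    [Ring V] [Algebra k V] [Module H V] [IsScalarTower k H V] [ModuleAlgebra k H V]
    (hV : IsQuantumCommutative (V := V) R) :
    -- `V # L` is a Hopf algebroid over `V`, and `d₀` is the inverse of `S(u)`
    ∃ (A : HopfAlgebroid k V (SmashProduct k V hR.leftHopfSubalgebra)) (d₀ : Hˣ),
      ((d₀⁻¹ : Hˣ) : H) = HopfAlgebra.antipode k (drinfeldElement R) ∧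
      -- source: `α(v) = v # 1`
      (∀ v : V, A.source v = SmashProduct.mk k v 1) ∧
      -- target: `β(v) = ∑ R² v # R¹`
      (∀ v : V, SmashProduct.incl V hR.leftHopfSubalgebra (A.tgt v) =
        TensorProduct.map ((Algebra.lsmul k k V).toLinearMap.flip v) LinearMap.id
          (TensorProduct.comm k H H R)) ∧
      -- coproduct: `Δ(v # l) = ∑ (v # l₁) ⊗ (1 # l₂)`
      (∀ (v : V) (l : hR.leftHopfSubalgebra), A.comul (SmashProduct.mk k v l) =
        A.proj (TensorProduct.map (SmashProduct.mkHom k _ v) (SmashProduct.mkHom k _ 1)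
          (Coalgebra.comul (R := k) l))) ∧
      -- counit: `ε(v # l) = ε(l) v`
      (∀ (v : V) (l : hR.leftHopfSubalgebra),
        A.counit (SmashProduct.mk k v l) = Coalgebra.counit (R := k) l • v) ∧
      -- antipode: `τ(v # l) = (1 # S(l)) β(d₀ v)`
      (∀ (v : V) (l : hR.leftHopfSubalgebra), A.antipode (SmashProduct.mk k v l) =
        SmashProduct.mk k 1 (HopfAlgebra.antipode k l) * A.tgt ((d₀ : H) • v)) := by
  obtain ⟨s, P⟩ := hR.exists_leftPresentation
  have hf (l : hR.leftHopfSubalgebra) (v : V) :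
    l • v = hR.leftHopfSubalgebra.toSubalgebra.val l • v := rfl
  -- The unit d₀ has value ∑ S²(R¹)R² and inverse ∑ R¹S(R²) = S(u).
  refine ⟨SmashProduct.hopfAlgebroid P hR hV hf
    hR.leftHopfSubalgebra_antipode_antipode_bijective, hR.antipodeDrinfeldInvUnit,
    hR.antipode_drinfeldElement_eq.symm, fun v => rfl, fun v => ?_, fun v l => ?_,
    SmashProduct.counit_mk, SmashProduct.antipodeMap_mk P hR hV hf⟩
  · refine (congrArg _ (SmashProduct.sourceTarget_tgt_eq_sum P hR hV hf v)).trans ?_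
    -- The target is built from a chosen presentation of R; inside V ⊗ H its value depends on R
    -- alone.
    have h := congrArg (TensorProduct.map ((Algebra.lsmul k k V).toLinearMap.flip v) LinearMap.id ∘ₗ
      (TensorProduct.comm k H H).toLinearMap) P.sum_eq
    rw [map_sum] at h ⊢
    exact h
  · exact congrArg _ (SmashProduct.coaction_mk k v l)
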